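/- **Setting.** Let $\mathcal U$ be the set of normalised $C^{1+Lip}$ unimodal maps: maps $f:[0,1]\to[0,1]$ which are $C^1$ with Lipschitz derivative, have exactly one critical point $c_f$, with $c_f\in(0,1)$, and satisfy $f(c_f)=1$ and $f(1)=0$. Give $\mathcal U$ the $C^1$ topology (uniform convergence of $f$ and $f'$). A map $f\in\mathcal U$ is *period tripling renormalizable* if $f(0)<c_f<f^4(0)$ and the interval $J=[f(0),f^4(0)]=[f^3(c_f),f^6(c_f)]$ satisfies $f^3(J)\subset J$ and $J,f(J),f^2(J)$ have pairwise disjoint interiors; then $Rf=h^{-1}\circ f^3\circ h\in\mathcal U$, where $h:[0,1]\to J$ is the orientation reversing affine homeomorphism. The topological entropy $h_{top}(R)$ is the supremum of $h_{top}(R|_\Lambda)$ over compact sets $\Lambda$ of renormalizable maps with $R(\Lambda)\subset\Lambda$. A map $f\in\mathcal U$ has a *quadratic tip* if there are $y_k\to c_f$, $y_k\ne c_f$, and $l>0$ with $\frac{f(y_k)-f(c_f)}{(y_k-c_f)^2}\to -l$. For $c\in(0,\frac12)$ let $u_c(x)=1-\left(\frac{x-c}{1-c}\right)^2$, $s_1=u_c^3(0)$,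 $s_2=u_c^4(0)-u_c(0)$, $s_3=1-u_c^2(0)$, $y_1=u_c(0)$, $z_1=u_c^4(0)$. Call $c$ a *fixed parameter* if $s_1,s_2,s_3>0$, $u_c^3(0)<u_c(0)$, $u_c^4(0)<u_c^2(0)$ and $\frac{u_c^4(0)-c}{s_2}=c$. Put $F_1(x)=u_c(0)+s_2(1-x)$, $F_2(y)=1-s_3(1-y)$, $F(x,y)=(F_1(x),F_2(y))$. Let $f_{s^*}$ be the map which on each of the intervals $F_1^k([0,s_1])$ and $F_1^k([1-s_3,1])$, $k\ge0$, is affine and agrees with $u_c$ at the end points. An *extension* of $f_{s^*}$ is a $C^{1+Lip}$ map $\psi:[0,y_1]\cup[z_1,1]\to[0,1]$ with nowhere vanishing derivative which agrees with $f_{s^*}$ wherever both are defined and whose derivatives at $y_1$ and $z_1$ are the slopes of $f_{s^*}$ on the adjacent intervals $F_1([1-s_3,1])$ and $F_1([0,s_1])$. **Theorem.** 1. There exists a fixed parameter $c$. 2. Let $c$ be a fixed parameter and $n\ge1$. There exist $n$ pairwise different extensions of $f_{s^*}$. For any $n$ pairwise different extensions $\psi_0,\dots,\psi_{n-1}$ there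 is a family $f_\alpha\in\mathcal U$, indexed by the sequences $\alpha=(\alpha_k)_{k\ge0}\in\Sigma_n=\{0,\dots,n-1\}^{\mathbb N}$, such that $\mathrm{graph}(f_\alpha)=\{(c,1)\}\cup\bigcup_{k\ge0}F^k(\mathrm{graph}\,\psi_{\alpha_k})$, every $f_\alpha$ extends $f_{s^*}$, has a quadratic tip and is period tripling renormalizable, $Rf_\alpha=f_{\sigma(\alpha)}$ with $\sigma$ the shift on $\Sigma_n$, and $\alpha\mapsto f_\alpha$ is a homeomorphism of $\Sigma_n$ (with the product topology) onto its image $\Lambda=\{f_\alpha\}$. Thus $R|_\Lambda$ is topologically conjugate to the full $n$-shift, and $h_{top}(R|_\Lambda)\ge\ln n$. 3. The period tripling renormalization operator $R$ on the space of $C^{1+Lip}$ unimodal maps has infinite topological entropy: $h_{top}(R)=\infty$. -/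

import Mathlib

open Set Filter Topology

namespace Tripling

/-! ### The space of unimodal maps with Lipschitz derivative -/

/-- A normalised `C^{1+Lip}` unimodal map of `[0,1]`: a differentiable self-map whose derivative is
Lipschitz and vanishes at exactly one point `crit`, which is interior, with critical value `1`, and
mapping `1` to `0`. The fields `slope` and `crit` are determined by `toMap`. -/
structure C1LipUnimodal where
  toMap : C(unitInterval, unitInterval)
  slope : C(unitInterval, ℝ)
  crit : unitInterval
  hasDeriv : ∀ x : unitInterval,
    HasDerivWithinAt (fun t : ℝ => (toMap (projIcc 0 1 zero_le_one t) : ℝ)) (slope x) (Icc 0 1) x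
  lip : ∃ K, LipschitzWith K slope
  slope_eq_zero_iff : ∀ x, slope x = 0 ↔ x = crit
  crit_pos : 0 < crit
  crit_lt_one : crit < 1
  map_crit : toMap crit = 1
  map_one : toMap 1 = 0

instance : CoeFun C1LipUnimodal (fun _ => unitInterval → unitInterval) := ⟨fun f => f.toMap⟩

/-- The `C^1` uniform structure: uniform convergence of the maps and of their derivatives. -/
instance : UniformSpace C1LipUnimodal :=
  UniformSpace.comap (fun f => (f.toMap, f.slope)) inferInstance

/-- `f` has a quadratic tip at its critical point. -/
def QuadraticTip (f : C1LipUnimodal) : Prop :=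
  ∃ y : ℕ → unitInterval, ∃ l : ℝ, 0 < l ∧ (∀ n, y n ≠ f.crit) ∧ Tendsto y atTop (𝓝 f.crit) ∧
    Tendsto (fun n => ((f (y n) : ℝ) - f f.crit) / ((y n : ℝ) - f.crit) ^ 2) atTop (𝓝 (-l))

/-! ### Period tripling renormalization -/

/-- The left end point `f(0) = f³(crit)` of the renormalization interval. -/
def left (f : C1LipUnimodal) : unitInterval := f 0

/-- The right end point `f⁴(0) = f⁶(crit)` of the renormalization interval. -/
def right (f : C1LipUnimodal) : unitInterval := f^[4] 0

/-- The renormalization interval. -/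
def interval (f : C1LipUnimodal) : Set unitInterval := Icc (left f) (right f)

/-- `f` is period tripling renormalizable: `J = [f(0), f⁴(0)]` is an interval around the critical
point, `J`, `f(J)`, `f²(J)` have pairwise disjoint interiors, and `f³(J) ⊆ J`. -/
structure IsRenormalizable (f : C1LipUnimodal) : Prop where
  left_lt : left f < f.crit
  lt_right : f.crit < right f
  disjoint₀₁ : Disjoint (interior (interval f)) (interior (f '' interval f))
  disjoint₀₂ : Disjoint (interior (interval f)) (interior (f^[2] '' interval f))
  disjoint₁₂ : Disjoint (interior (f '' interval f)) (interior (f^[2] '' interval f))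
  mapsTo : MapsTo f^[3] (interval f) (interval f)

/-- The orientation reversing affine map of `[0,1]` onto the renormalization interval. -/
def rescale (f : C1LipUnimodal) : C(unitInterval, unitInterval) where
  toFun t := ⟨(right f : ℝ) - ((right f : ℝ) - left f) * t, by
    have h1 := (right f).2
    have h2 := (left f).2
    have h3 := t.2
    constructor
    · nlinarith [mul_nonneg h1.1 (sub_nonneg.2 h3.2), mul_nonneg h2.1 h3.1]
    · nlinarith [mul_nonneg (sub_nonneg.2 h1.2) (sub_nonneg.2 h3.2),
        mul_nonneg (sub_nonneg.2 h2.2) h3.1]⟩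
  continuous_toFun := by fun_prop

theorem coe_rescale (f : C1LipUnimodal) (t : unitInterval) :
    (rescale f t : ℝ) = (right f : ℝ) - ((right f : ℝ) - left f) * t := rfl

theorem C1LipUnimodal.lipschitz (f : C1LipUnimodal) : ∃ K, LipschitzWith K f.toMap := by
  obtain ⟨C, hC⟩ := (isCompact_range f.slope.continuous).isBounded.exists_norm_le
  have key := Convex.lipschitzOnWith_of_nnnorm_hasDerivWithin_le (C := C.toNNReal)
    (f := fun t : ℝ => (f.toMap (projIcc 0 1 zero_le_one t) : ℝ))
    (f' := fun t : ℝ => f.slope (projIcc 0 1 zero_le_one t)) (convex_Icc (0 : ℝ) 1)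
    (fun x hx => by simpa [projIcc_of_mem zero_le_one hx] using f.hasDeriv ⟨x, hx⟩)
    (fun x _ => by
      rw [← NNReal.coe_le_coe, coe_nnnorm]
      exact (hC _ (mem_range_self _)).trans (Real.le_coe_toNNReal C))
  refine ⟨C.toNNReal, LipschitzWith.of_dist_le_mul fun x y => ?_⟩
  have := key.dist_le_mul x x.2 y y.2
  simpa [Subtype.dist_eq] using this

theorem lipschitz_mul {g h : C(unitInterval, ℝ)} (hg : ∃ K, LipschitzWith K g)
    (hh : ∃ K, LipschitzWith K h) : ∃ K, LipschitzWith K (g * h) := by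
  obtain ⟨K, hK⟩ := hg
  obtain ⟨L, hL⟩ := hh
  refine ⟨‖g‖₊ * L + ‖h‖₊ * K, LipschitzWith.of_dist_le_mul fun x y => ?_⟩
  have h1 := hK.dist_le_mul x y
  have h2 := hL.dist_le_mul x y
  rw [Real.dist_eq] at h1 h2 ⊢
  have e : (g * h) x - (g * h) y = g x * (h x - h y) + h y * (g x - g y) := by
    simp only [ContinuousMap.mul_apply]; ring
  rw [e]
  refine (abs_add_le _ _).trans ?_
  rw [abs_mul, abs_mul]
  have g1 : |g x| ≤ ‖g‖ := g.norm_coe_le_norm x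
  have g2 : |h y| ≤ ‖h‖ := h.norm_coe_le_norm y
  calc |g x| * |h x - h y| + |h y| * |g x - g y|
      ≤ ‖g‖ * (L * dist x y) + ‖h‖ * (K * dist x y) := by gcongr
    _ = _ := by push_cast; ring

theorem length_pos {f : C1LipUnimodal} (hf : IsRenormalizable f) :
    (0 : ℝ) < (right f : ℝ) - left f := by
  have h : (left f : ℝ) < right f := hf.left_lt.trans hf.lt_right
  linarith

theorem rescale_mem {f : C1LipUnimodal} (hf : IsRenormalizable f) (t : unitInterval) :
    rescale f t ∈ interval f := by
  have h : (left f : ℝ) < right f := hf.left_lt.trans hf.lt_right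
  have h3 := t.2
  constructor
  · change (left f : ℝ) ≤ rescale f t
    rw [coe_rescale]; nlinarith [mul_nonneg (sub_pos.2 h).le (sub_nonneg.2 h3.2)]
  · change (rescale f t : ℝ) ≤ right f
    rw [coe_rescale]; nlinarith [mul_nonneg (sub_pos.2 h).le h3.1]

theorem rescale_lipschitz (f : C1LipUnimodal) : ∃ K, LipschitzWith K (rescale f) := by
  refine ⟨‖(right f : ℝ) - left f‖₊, LipschitzWith.of_dist_le_mul fun x y => ?_⟩
  rw [Subtype.dist_eq, coe_rescale, coe_rescale, Subtype.dist_eq, Real.dist_eq, Real.dist_eq,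
    coe_nnnorm, Real.norm_eq_abs, ← abs_mul, abs_sub_comm]
  apply le_of_eq
  congr 1; ring

/-- The renormalized map `h⁻¹ ∘ f³ ∘ h`, where `h` is `rescale f`. -/
noncomputable def renormMap (f : C1LipUnimodal) (hf : IsRenormalizable f) :
    C(unitInterval, unitInterval) where
  toFun t := ⟨((right f : ℝ) - f^[3] (rescale f t)) / ((right f : ℝ) - left f), by
    have h := length_pos hf
    have h1 : (left f : ℝ) ≤ f^[3] (rescale f t) := (hf.mapsTo (rescale_mem hf t)).1
    have h2 : (f^[3] (rescale f t) : ℝ) ≤ right f := (hf.mapsTo (rescale_mem hf t)).2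
    exact ⟨div_nonneg (by linarith) h.le, (div_le_one h).2 (by linarith)⟩⟩
  continuous_toFun := by
    have : Continuous (f^[3]) := f.toMap.continuous.iterate 3
    fun_prop

theorem coe_renormMap (f : C1LipUnimodal) (hf : IsRenormalizable f) (t : unitInterval) :
    (renormMap f hf t : ℝ)
      = ((right f : ℝ) - f^[3] (rescale f t)) / ((right f : ℝ) - left f) := rfl

/-- `renormMap f hf` really is `h⁻¹ ∘ f³ ∘ h`. -/
theorem rescale_renormMap (f : C1LipUnimodal) (hf : IsRenormalizable f) (t : unitInterval) :
    rescale f (renormMap f hf t) = f^[3] (rescale f t) := by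
  have h : (right f : ℝ) - left f ≠ 0 := (length_pos hf).ne'
  apply Subtype.ext
  rw [coe_rescale, coe_renormMap, mul_div_cancel₀ _ h]
  ring

/-- Derivative of the renormalized map. -/
def renormSlope (f : C1LipUnimodal) : C(unitInterval, ℝ) :=
  (f.slope.comp (f.toMap.comp (f.toMap.comp (rescale f)))) *
    ((f.slope.comp (f.toMap.comp (rescale f))) * (f.slope.comp (rescale f)))

theorem renormSlope_lipschitz (f : C1LipUnimodal) : ∃ K, LipschitzWith K (renormSlope f) := by
  obtain ⟨A, hA⟩ := f.lipschitz
  obtain ⟨B, hB⟩ := f.lip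
  obtain ⟨C, hC⟩ := rescale_lipschitz f
  exact lipschitz_mul ⟨_, hB.comp (hA.comp (hA.comp hC))⟩
    (lipschitz_mul ⟨_, hB.comp (hA.comp hC)⟩ ⟨_, hB.comp hC⟩)

theorem renorm_hasDeriv (f : C1LipUnimodal) (hf : IsRenormalizable f) (x : unitInterval) :
    HasDerivWithinAt (fun t : ℝ => (renormMap f hf (projIcc 0 1 zero_le_one t) : ℝ))
      (renormSlope f x) (Icc 0 1) x := by
  have h : (right f : ℝ) - left f ≠ 0 := (length_pos hf).ne'
  set E : ℝ → ℝ := fun t => (f.toMap (projIcc 0 1 zero_le_one t) : ℝ) with hE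
  have E_coe : ∀ y : unitInterval, E y = f y := fun y => by simp [hE]
  have E_maps : MapsTo E (Icc 0 1) (Icc 0 1) := fun t _ => (f.toMap _).2
  set H : ℝ → ℝ := fun t => (right f : ℝ) - ((right f : ℝ) - left f) * t with hH
  have H_coe : ∀ y : unitInterval, H y = rescale f y := fun y => rfl
  have H_maps : MapsTo H (Icc 0 1) (Icc 0 1) := fun t ht => by
    have := H_coe ⟨t, ht⟩
    change H t = _ at this
    rw [this]; exact (rescale f _).2
  have dH : HasDerivWithinAt H (-((right f : ℝ) - left f)) (Icc 0 1) x := by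
    have := ((hasDerivAt_id (x : ℝ)).const_mul ((right f : ℝ) - left f)).const_sub (right f : ℝ)
    simpa [hH] using this.hasDerivWithinAt
  have d1 : HasDerivWithinAt E (f.slope (rescale f x)) (Icc 0 1) (H x) := by
    rw [H_coe]; exact f.hasDeriv _
  have c1 := d1.comp (x : ℝ) dH H_maps
  have e1 : (E ∘ H) x = f (rescale f x) := by simp only [Function.comp, H_coe, E_coe]
  have d2 : HasDerivWithinAt E (f.slope (f (rescale f x))) (Icc 0 1) ((E ∘ H) x) := by
    rw [e1]; exact f.hasDeriv _
  have c2 := d2.comp (x : ℝ) c1 (E_maps.comp H_maps)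
  have e2 : (E ∘ E ∘ H) x = f (f (rescale f x)) := by
    simp only [Function.comp, H_coe, E_coe]
  have d3 : HasDerivWithinAt E (f.slope (f (f (rescale f x)))) (Icc 0 1) ((E ∘ E ∘ H) x) := by
    rw [e2]; exact f.hasDeriv _
  have c3 := d3.comp (x : ℝ) c2 (E_maps.comp (E_maps.comp H_maps))
  have c4 := (c3.const_sub (right f : ℝ)).div_const ((right f : ℝ) - left f)
  refine (c4.congr_of_mem (fun t ht => ?_) x.2).congr_deriv ?_
  · rw [coe_renormMap, projIcc_of_mem zero_le_one ht]
    have := H_coe ⟨t, ht⟩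
    change H t = _ at this
    simp only [Function.comp, this, E_coe]
    rfl
  · simp only [renormSlope, ContinuousMap.mul_apply, ContinuousMap.comp_apply]
    field_simp

/-- No point of `J` is mapped to the critical point by `f` or by `f²`. -/
theorem crit_not_mem {f : C1LipUnimodal} (hf : IsRenormalizable f) :
    f.crit ∉ f '' interval f ∧ f.crit ∉ f^[2] '' interval f := by
  have lt : left f < right f := hf.left_lt.trans hf.lt_right
  -- a connected set which has the critical point and another point meets `interior J` in an
  -- open interval
  have key : ∀ s : Set unitInterval, s.OrdConnected → f.crit ∈ s → (∃ y ∈ s, y ≠ f.crit) →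
      ¬ Disjoint (interior (interval f)) (interior s) := by
    rintro s hs hc ⟨y, hy, hne⟩ hd
    have hJ : Ioo (left f) (right f) ⊆ interior (interval f) :=
      interior_maximal Ioo_subset_Icc_self isOpen_Ioo
    rcases lt_or_gt_of_ne hne with hlt | hlt
    · obtain ⟨z, hz1, hz2⟩ := exists_between (max_lt hlt hf.left_lt)
      have hS : Ioo y f.crit ⊆ interior s :=
        interior_maximal (Ioo_subset_Icc_self.trans (hs.out hy hc)) isOpen_Ioo
      exact Set.disjoint_left.1 hd
        (hJ ⟨(le_max_right _ _).trans_lt hz1, hz2.trans hf.lt_right⟩)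
        (hS ⟨(le_max_left _ _).trans_lt hz1, hz2⟩)
    · obtain ⟨z, hz1, hz2⟩ := exists_between (lt_min hlt hf.lt_right)
      have hS : Ioo f.crit y ⊆ interior s :=
        interior_maximal (Ioo_subset_Icc_self.trans (hs.out hc hy)) isOpen_Ioo
      exact Set.disjoint_left.1 hd
        (hJ ⟨hf.left_lt.trans hz1, hz2.trans_le (min_le_right _ _)⟩)
        (hS ⟨hz1, hz2.trans_le (min_le_left _ _)⟩)
  have hJc : IsPreconnected (interval f) := isPreconnected_Icc
  have hcJ : f.crit ∈ interval f := ⟨hf.left_lt.le, hf.lt_right.le⟩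
  have f1 : f f.crit = 1 := f.map_crit
  have f2 : f^[2] f.crit = 0 := by
    simp only [Function.iterate_succ, Function.iterate_zero, Function.comp, id]
    rw [f1]; exact f.map_one
  constructor
  · intro hmem
    exact key _ (hJc.image _ f.toMap.continuous.continuousOn).ordConnected hmem
      ⟨1, ⟨_, hcJ, f1⟩, f.crit_lt_one.ne'⟩ hf.disjoint₀₁
  · intro hmem
    exact key _ (hJc.image _ (f.toMap.continuous.iterate 2).continuousOn).ordConnected hmem
      ⟨0, ⟨_, hcJ, f2⟩, f.crit_pos.ne⟩ hf.disjoint₀₂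

/-- The renormalization of a period tripling renormalizable map, as a unimodal map. -/
noncomputable def renormalize (f : C1LipUnimodal) (hf : IsRenormalizable f) : C1LipUnimodal where
  toMap := renormMap f hf
  slope := renormSlope f
  crit := ⟨((right f : ℝ) - f.crit) / ((right f : ℝ) - left f), by
    have h := length_pos hf
    have h1 : (left f : ℝ) < f.crit := hf.left_lt
    have h2 : (f.crit : ℝ) < right f := hf.lt_right
    exact ⟨div_nonneg (by linarith) h.le, (div_le_one h).2 (by linarith)⟩⟩
  hasDeriv := renorm_hasDeriv f hf
  lip := renormSlope_lipschitz f
  slope_eq_zero_iff := fun x => by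
    have h := length_pos hf
    have n1 : f (rescale f x) ≠ f.crit := fun e =>
      (crit_not_mem hf).1 ⟨_, rescale_mem hf x, e⟩
    have n2 : f (f (rescale f x)) ≠ f.crit := fun e =>
      (crit_not_mem hf).2 ⟨_, rescale_mem hf x, e⟩
    have e : renormSlope f x = 0 ↔ rescale f x = f.crit := by
      simp only [renormSlope, ContinuousMap.mul_apply, ContinuousMap.comp_apply, mul_eq_zero,
        f.slope_eq_zero_iff]
      tauto
    rw [e, Subtype.ext_iff, Subtype.ext_iff, coe_rescale, eq_div_iff h.ne']
    constructor <;> intro h' <;> linarith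
  crit_pos := by
    have h := length_pos hf
    have h2 : (f.crit : ℝ) < right f := hf.lt_right
    exact Subtype.mk_lt_mk.2 (div_pos (by linarith) h)
  crit_lt_one := by
    have h := length_pos hf
    have h1 : (left f : ℝ) < f.crit := hf.left_lt
    exact Subtype.mk_lt_mk.2 ((div_lt_one h).2 (by linarith))
  map_crit := by
    have h : (right f : ℝ) - left f ≠ 0 := (length_pos hf).ne'
    apply Subtype.ext
    rw [coe_renormMap]
    have e : ∀ t : unitInterval, (t : ℝ) = ((right f : ℝ) - f.crit) / ((right f : ℝ) - left f) →
        rescale f t = f.crit := fun t ht => by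
      apply Subtype.ext
      rw [coe_rescale, ht, mul_div_cancel₀ _ h]; ring
    rw [e _ rfl]
    have f1 : f f.crit = 1 := f.map_crit
    have f2 : f 1 = 0 := f.map_one
    have f3 : f^[3] f.crit = left f := by
      simp only [Function.iterate_succ, Function.iterate_zero, Function.comp, id]
      rw [f1, f2]; rfl
    rw [f3, div_self h]; rfl
  map_one := by
    apply Subtype.ext
    rw [coe_renormMap]
    have e : rescale f 1 = left f := by
      apply Subtype.ext
      rw [coe_rescale]; simp
    have e' : f^[3] (left f) = right f := rfl
    rw [e, e', sub_self, zero_div]; rfl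

open Classical in
/-- The period tripling renormalization operator. Its domain is the set of renormalizable maps;
elsewhere it gets the dummy value `f`. -/
noncomputable def R (f : C1LipUnimodal) : C1LipUnimodal :=
  if hf : IsRenormalizable f then renormalize f hf else f

/-- The topological entropy of the (partially defined, on a non-compact space) operator `R`: the
supremum of the topological entropies of its restrictions to the compact forward invariant subsets
of its domain. -/
noncomputable def entropyR : EReal :=
  ⨆ (S : Set C1LipUnimodal) (_ : IsCompact S) (_ : ∀ f ∈ S, IsRenormalizable f)
    (_ : MapsTo R S S), Dynamics.coverEntropy R S

/-! ### The piecewise affine renormalization fixed point and its extensions -/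

/-- The quadratic family `u_c`. -/
noncomputable def u (c x : ℝ) : ℝ := 1 - ((x - c) / (1 - c)) ^ 2

/-- The scaling tri-factor determined by `c`. -/
noncomputable def s₁ (c : ℝ) : ℝ := (u c)^[3] 0
noncomputable def s₂ (c : ℝ) : ℝ := (u c)^[4] 0 - u c 0
noncomputable def s₃ (c : ℝ) : ℝ := 1 - (u c)^[2] 0

/-- `c` is in the feasible domain and is a fixed point of the induced map on critical points
`c ↦ (u_c⁴(0) - c) / s₂(c)`. -/
structure IsFixedParameter (c : ℝ) : Prop where
  pos : 0 < c
  lt_half : c < 1 / 2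
  s₁_pos : 0 < s₁ c
  s₂_pos : 0 < s₂ c
  s₃_pos : 0 < s₃ c
  gap_left : 0 < u c 0 - (u c)^[3] 0
  gap_right : 0 < (u c)^[2] 0 - (u c)^[4] 0
  fixed : ((u c)^[4] 0 - c) / s₂ c = c

/-- Horizontal and vertical parts of the scaling function. -/
noncomputable def F₁ (c x : ℝ) : ℝ := u c 0 + s₂ c * (1 - x)
noncomputable def F₂ (c y : ℝ) : ℝ := 1 - s₃ c * (1 - y)

/-- The scaling function `F` on the plane. -/
noncomputable def F (c : ℝ) (p : ℝ × ℝ) : ℝ × ℝ := (F₁ c p.1, F₂ c p.2)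

/-- The affine function agreeing with `g` at `a` and `b`. -/
noncomputable def chord (g : ℝ → ℝ) (a b x : ℝ) : ℝ := g a + slope g a b * (x - a)

/-- `g` agrees on the set `D` with the piecewise affine map which, on each of the intervals
`F₁ⁿ[0, s₁]` and `F₁ⁿ[1 - s₃, 1]` (`n ≥ 0`), is affine and equal to `u_c` at the end points. -/
def ExtendsOn (c : ℝ) (g : ℝ → ℝ) (D : Set ℝ) : Prop :=
  ∀ n : ℕ,
    EqOn g (chord (u c) ((F₁ c)^[n] 0) ((F₁ c)^[n] (s₁ c))) (D ∩ (F₁ c)^[n] '' Icc 0 (s₁ c)) ∧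
    EqOn g (chord (u c) ((F₁ c)^[n] (1 - s₃ c)) ((F₁ c)^[n] 1))
      (D ∩ (F₁ c)^[n] '' Icc (1 - s₃ c) 1)

/-- `[0, y₁] ∪ [z₁, 1]` with `y₁ = u_c(0) = F₁(1)` and `z₁ = u_c⁴(0) = F₁(0)`. -/
noncomputable def dom (c : ℝ) : Set ℝ := Icc 0 (u c 0) ∪ Icc ((u c)^[4] 0) 1

/-- `ψ` is a `C^{1+Lip}` map `[0, y₁] ∪ [z₁, 1] → [0,1]` without critical points extending the
piecewise affine map; at `y₁` and `z₁` its derivative is the slope of the adjacent affine pieces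
of the second level, over `F₁[1 - s₃, 1]` and `F₁[0, s₁]`. -/
structure IsExtension (c : ℝ) (ψ : ℝ → ℝ) : Prop where
  mapsTo : MapsTo ψ (dom c) (Icc 0 1)
  extends_affine : ExtendsOn c ψ (dom c)
  c1_lip : ∃ d : ℝ → ℝ, (∀ x ∈ dom c, HasDerivWithinAt ψ (d x) (dom c) x) ∧
    (∃ K, LipschitzOnWith K d (dom c)) ∧ (∀ x ∈ dom c, d x ≠ 0) ∧
    d (F₁ c 1) = slope (u c) (F₁ c (1 - s₃ c)) (F₁ c 1) ∧
    d (F₁ c 0) = slope (u c) (F₁ c 0) (F₁ c (s₁ c))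

/-- The graph of `ψ` over its domain. -/
def graphOn (c : ℝ) (ψ : ℝ → ℝ) : Set (ℝ × ℝ) := {p | p.1 ∈ dom c ∧ p.2 = ψ p.1}

/-- The graph of a unimodal map. -/
def C1LipUnimodal.graph (f : C1LipUnimodal) : Set (ℝ × ℝ) :=
  range fun x : unitInterval => ((x : ℝ), (f x : ℝ))

/-- The one-sided shift `(σ α)_k = α_{k+1}`. -/
def shift {n : ℕ} (α : ℕ → Fin n) : ℕ → Fin n := fun k => α (k + 1)

end Tripling

namespace Tripling

/-! ### Fixed parameters -/

theorem exists_isFixedParameter : ∃ c, IsFixedParameter c := by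
  have bounds : ∀ c ∈ Icc (0.4402 : ℝ) 0.4403,
      (u c 0 ∈ Icc (0.381 : ℝ) 0.3817) ∧ ((u c)^[2] 0 ∈ Icc (0.9887 : ℝ) 0.9892) ∧
      ((u c)^[3] 0 ∈ Icc (0.037 : ℝ) 0.041) ∧ ((u c)^[4] 0 ∈ Icc (0.48 : ℝ) 0.492) := by
    rintro c ⟨hc0, hc1⟩
    have hc : 0 < 1 - c := by linarith
    have step : ∀ x a b : ℝ, 0 ≤ a → a * (1 - c) ≤ |x - c| → |x - c| ≤ b * (1 - c) →
        u c x ∈ Icc (1 - b ^ 2) (1 - a ^ 2) := by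
      intro x a b ha h1 h2
      have e : u c x = 1 - (|x - c| / (1 - c)) ^ 2 := by
        rw [u, div_pow, div_pow, sq_abs]
      have k1 : a ≤ |x - c| / (1 - c) := (le_div_iff₀ hc).2 h1
      have k2 : |x - c| / (1 - c) ≤ b := (div_le_iff₀ hc).2 h2
      rw [e]
      constructor
      · have := pow_le_pow_left₀ (ha.trans k1) k2 2; linarith
      · have := pow_le_pow_left₀ ha k1 2; linarith
    have b1 : u c 0 ∈ Icc (0.381 : ℝ) 0.3817 := by
      have := step 0 0.78635 0.7867 (by norm_num) (by rw [abs_of_nonpos] <;> linarith)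
        (by rw [abs_of_nonpos] <;> linarith)
      norm_num at this ⊢; constructor <;> linarith
    have b2 : (u c)^[2] 0 ∈ Icc (0.9887 : ℝ) 0.9892 := by
      have := step (u c 0) 0.1044 0.106 (by norm_num) (by rw [abs_of_nonpos] <;> linarith [b1.1, b1.2])
        (by rw [abs_of_nonpos] <;> linarith [b1.1, b1.2])
      norm_num at this ⊢; constructor <;> linarith
    have b3 : (u c)^[3] 0 ∈ Icc (0.037 : ℝ) 0.041 := by
      have := step ((u c)^[2] 0) 0.9796 0.981 (by norm_num)
        (by rw [abs_of_nonneg] <;> linarith [b2.1, b2.2])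
        (by rw [abs_of_nonneg] <;> linarith [b2.1, b2.2])
      rw [Function.iterate_succ_apply' _ 2]
      norm_num at this ⊢; constructor <;> linarith
    have b4 : (u c)^[4] 0 ∈ Icc (0.48 : ℝ) 0.492 := by
      have := step ((u c)^[3] 0) 0.713 0.7206 (by norm_num)
        (by rw [abs_of_nonpos] <;> linarith [b3.1, b3.2])
        (by rw [abs_of_nonpos] <;> linarith [b3.1, b3.2])
      rw [Function.iterate_succ_apply' _ 3]
      norm_num at this ⊢; constructor <;> linarith
    exact ⟨b1, b2, b3, b4⟩
  have hcont : ∀ k : ℕ, ContinuousOn (fun c => (u c)^[k] 0) (Icc (0.4402 : ℝ) 0.4403) := by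
    intro k
    induction k with
    | zero => exact continuousOn_const
    | succ k ih =>
      simp only [Function.iterate_succ_apply', u]
      refine continuousOn_const.sub (((ih.sub continuousOn_id).div
        (continuousOn_const.sub continuousOn_id) fun c hc => ?_).pow 2)
      have := hc.2
      norm_num at this ⊢; linarith
  obtain ⟨c, hc, h0⟩ : (0 : ℝ) ∈ (fun c : ℝ => (u c)^[4] 0 - c - c * ((u c)^[4] 0 - (u c)^[1] 0)) ''
      Icc (0.4402 : ℝ) 0.4403 := by
    refine intermediate_value_Icc (by norm_num) (((hcont 4).sub continuousOn_id).sub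
      (continuousOn_id.mul ((hcont 4).sub (hcont 1)))) ⟨?_, ?_⟩
    · norm_num [u]
    · norm_num [u]
  obtain ⟨b1, b2, b3, b4⟩ := bounds c hc
  norm_num at b1 b2 b3 b4 hc h0
  have hs : 0 < s₂ c := by norm_num [s₂]; linarith
  refine ⟨c, ⟨by linarith, by linarith, by norm_num [s₁]; linarith, hs,
    by norm_num [s₃]; linarith, by norm_num; linarith, by norm_num; linarith, ?_⟩⟩
  rw [div_eq_iff hs.ne']
  norm_num [s₂]; linarith

namespace IsFixedParameter

variable {c : ℝ}

theorem right_eq (h : IsFixedParameter c) : (u c)^[4] 0 = c + s₂ c * c := by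
  have := (div_eq_iff h.s₂_pos.ne').1 h.fixed
  linarith

theorem left_eq (h : IsFixedParameter c) : u c 0 = c - s₂ c * (1 - c) := by
  have : s₂ c = (u c)^[4] 0 - u c 0 := rfl
  linarith [h.right_eq]

theorem F₁_eq (h : IsFixedParameter c) (x : ℝ) : F₁ c x = c - s₂ c * (x - c) := by
  rw [F₁, h.left_eq]; ring

theorem F₁_one (_ : IsFixedParameter c) : F₁ c 1 = u c 0 := by simp [F₁]

theorem F₁_zero (_ : IsFixedParameter c) : F₁ c 0 = (u c)^[4] 0 := by simp [F₁, s₂]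

theorem s₁_lt (h : IsFixedParameter c) : s₁ c < u c 0 := sub_pos.1 h.gap_left

theorem left_pos (h : IsFixedParameter c) : 0 < u c 0 := h.s₁_pos.trans h.s₁_lt

theorem left_lt (h : IsFixedParameter c) : u c 0 < c := by
  have := mul_pos h.s₂_pos (show 0 < 1 - c by linarith [h.lt_half])
  linarith [h.left_eq]

theorem lt_right (h : IsFixedParameter c) : c < (u c)^[4] 0 := by
  have := mul_pos h.s₂_pos h.pos
  linarith [h.right_eq]

theorem right_lt (h : IsFixedParameter c) : (u c)^[4] 0 < 1 - s₃ c := by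
  have := h.gap_right
  simp only [s₃]; linarith

theorem lt_one (h : IsFixedParameter c) : c < 1 := by linarith [h.lt_half]

theorem right_lt_one (h : IsFixedParameter c) : (u c)^[4] 0 < 1 := by
  linarith [h.right_lt, h.s₃_pos]

theorem s₂_lt_one (h : IsFixedParameter c) : s₂ c < 1 := by
  have : s₂ c = (u c)^[4] 0 - u c 0 := rfl
  linarith [h.right_lt_one, h.left_pos]

theorem u_F₁ (h : IsFixedParameter c) (x : ℝ) : u c (F₁ c x) = 1 - s₂ c ^ 2 * (1 - u c x) := by
  simp only [u, h.F₁_eq]; ring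

theorem u_one (h : IsFixedParameter c) : u c 1 = 0 := by
  have : 1 - c ≠ 0 := by linarith [h.lt_half]
  simp [u, div_self this]

theorem s₃_eq (h : IsFixedParameter c) : s₃ c = s₂ c ^ 2 := by
  have : (u c)^[2] 0 = u c (F₁ c 1) := by rw [h.F₁_one]; rfl
  rw [s₃, this, h.u_F₁, h.u_one]; ring

theorem s₃_lt_one (h : IsFixedParameter c) : s₃ c < 1 := by
  rw [h.s₃_eq]; nlinarith [h.s₂_pos, h.s₂_lt_one]

theorem u_F₁' (h : IsFixedParameter c) (x : ℝ) : u c (F₁ c x) = F₂ c (u c x) := by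
  rw [h.u_F₁, F₂, h.s₃_eq]

theorem u_one_sub (_ : IsFixedParameter c) : u c (1 - s₃ c) = s₁ c := by
  rw [s₃, sub_sub_cancel]; rfl

theorem u_s₁ (_ : IsFixedParameter c) : u c (s₁ c) = (u c)^[4] 0 := rfl

theorem mem_F₁_image (h : IsFixedParameter c) {x : ℝ} (hx : x ∈ Icc (u c 0) ((u c)^[4] 0)) :
    ∃ w ∈ Icc (0 : ℝ) 1, x = F₁ c w := by
  have hs := h.s₂_pos
  have hx1 := hx.1
  have hx2 := hx.2
  rw [h.left_eq] at hx1
  rw [h.right_eq] at hx2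
  refine ⟨c - (x - c) / s₂ c, ⟨?_, ?_⟩, ?_⟩
  · rw [sub_nonneg, div_le_iff₀ hs]; linarith
  · rw [sub_le_iff_le_add, ← sub_le_iff_le_add', le_div_iff₀ hs]; linarith
  · rw [h.F₁_eq]; field_simp; ring

theorem F₁_mem (h : IsFixedParameter c) {w : ℝ} (hw : w ∈ Icc (0 : ℝ) 1) :
    F₁ c w ∈ Icc (u c 0) ((u c)^[4] 0) := by
  have hs := h.s₂_pos
  rw [h.F₁_eq, h.left_eq, h.right_eq]
  constructor <;> nlinarith [mul_nonneg hs.le hw.1, mul_nonneg hs.le (sub_nonneg.2 hw.2)]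

theorem Icc_subset (h : IsFixedParameter c) : Icc (u c 0) ((u c)^[4] 0) ⊆ Icc (0 : ℝ) 1 :=
  Icc_subset_Icc h.left_pos.le h.right_lt_one.le

theorem F₁_mem_unit (h : IsFixedParameter c) {w : ℝ} (hw : w ∈ Icc (0 : ℝ) 1) :
    F₁ c w ∈ Icc (0 : ℝ) 1 := h.Icc_subset (h.F₁_mem hw)

theorem F₁_iterate (h : IsFixedParameter c) (k : ℕ) (x : ℝ) :
    (F₁ c)^[k] x = c + (-s₂ c) ^ k * (x - c) := by
  induction k with
  | zero => simp
  | succ k ih => rw [Function.iterate_succ_apply', ih, h.F₁_eq]; ring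

theorem F₂_iterate (c : ℝ) (k : ℕ) (y : ℝ) : (F₂ c)^[k] y = 1 - s₃ c ^ k * (1 - y) := by
  induction k with
  | zero => simp
  | succ k ih => rw [Function.iterate_succ_apply', ih, F₂]; ring

theorem dom_subset (h : IsFixedParameter c) : dom c ⊆ Icc 0 1 := by
  rintro x (hx | hx)
  · exact ⟨hx.1, hx.2.trans (h.left_lt.trans h.lt_one).le⟩
  · exact ⟨(h.pos.trans h.lt_right).le.trans hx.1, hx.2⟩

theorem mem_dom_of_notMem {c x : ℝ} (hx : x ∈ Icc (0 : ℝ) 1)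
    (hJ : x ∉ Icc (u c 0) ((u c)^[4] 0)) : x ∈ dom c := by
  rcases lt_or_ge x (u c 0) with h1 | h1
  · exact Or.inl ⟨hx.1, h1.le⟩
  · exact Or.inr ⟨le_of_not_ge fun h2 => hJ ⟨h1, h2⟩, hx.2⟩

theorem notMem_dom (h : IsFixedParameter c) : c ∉ dom c := by
  rintro (hx | hx)
  · exact absurd hx.2 (not_le.2 h.left_lt)
  · exact absurd hx.1 (not_le.2 h.lt_right)

theorem zero_mem_dom (h : IsFixedParameter c) : (0 : ℝ) ∈ dom c := Or.inl ⟨le_rfl, h.left_pos.le⟩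

theorem one_mem_dom (h : IsFixedParameter c) : (1 : ℝ) ∈ dom c :=
  Or.inr ⟨h.right_lt_one.le, le_rfl⟩

theorem left_mem_dom (h : IsFixedParameter c) : u c 0 ∈ dom c := Or.inl ⟨h.left_pos.le, le_rfl⟩

theorem right_mem_dom (h : IsFixedParameter c) : (u c)^[4] 0 ∈ dom c :=
  Or.inr ⟨le_rfl, h.right_lt_one.le⟩

/-- The two levels `dom c` and `F₁ [0,1]` meet only at the end points. -/
theorem eq_zero_or_one_of_F₁_mem_dom (h : IsFixedParameter c) {w : ℝ} (hw : w ∈ Icc (0 : ℝ) 1)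
    (hd : F₁ c w ∈ dom c) : w = 0 ∨ w = 1 := by
  have hs := h.s₂_pos
  rcases hd with hx | hx
  · right
    have := hx.2
    rw [h.F₁_eq, h.left_eq] at this
    exact le_antisymm hw.2 (le_of_mul_le_mul_left (by linarith) hs)
  · left
    have := hx.1
    rw [h.F₁_eq, h.right_eq] at this
    exact le_antisymm (le_of_mul_le_mul_left (by linarith) hs) hw.1

/-- Every point of `[0,1]` other than `c` is reached from the outermost level by `F₁`. -/
theorem induction (h : IsFixedParameter c) {P : ℝ → Prop}
    (base : ∀ x ∈ Icc (0 : ℝ) 1, x ∉ Icc (u c 0) ((u c)^[4] 0) → P x)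
    (step : ∀ w ∈ Icc (0 : ℝ) 1, P w → P (F₁ c w)) {x : ℝ} (hx : x ∈ Icc (0 : ℝ) 1)
    (hxc : x ≠ c) : P x := by
  have hs := h.s₂_pos
  have main : ∀ k : ℕ, ∀ x ∈ Icc (0 : ℝ) 1, s₂ c ^ k ≤ |x - c| → P x := by
    intro k
    induction k with
    | zero =>
      intro x hx hk
      exfalso
      have : |x - c| < 1 := abs_lt.2 ⟨by linarith [hx.1, h.lt_one], by linarith [hx.2, h.pos]⟩
      simp at hk; linarith
    | succ k ih =>
      intro x hx hk
      by_cases hJ : x ∈ Icc (u c 0) ((u c)^[4] 0)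
      · obtain ⟨w, hw, rfl⟩ := h.mem_F₁_image hJ
        refine step w hw (ih w hw ?_)
        rw [h.F₁_eq, show c - s₂ c * (w - c) - c = -(s₂ c * (w - c)) by ring, abs_neg, abs_mul,
          abs_of_pos hs, pow_succ'] at hk
        exact le_of_mul_le_mul_left hk hs
      · exact base x hx hJ
  obtain ⟨k, hk⟩ := exists_pow_lt_of_lt_one (abs_pos.2 (sub_ne_zero.2 hxc)) h.s₂_lt_one
  exact main k x hx hk.le

end IsFixedParameter

/-! ### Gluing rescaled copies of functions on `dom c` -/

section Glue

variable {ι : Type*}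

open Classical in
/-- The function equal to `A (α k)` on `dom c`, copied to `(F₁ c)^[k] (dom c)` and rescaled in the
range by the `k`-th iterate of the affine map of slope `r` fixing `e`; its value at `c` is `e`. -/
noncomputable def glue (c e r : ℝ) (A : ι → ℝ → ℝ) (α : ℕ → ι) (x : ℝ) : ℝ :=
  if hx : ∃ k : ℕ, (fun t => c - (t - c) / s₂ c)^[k] x ∈ dom c then
    e + r ^ Nat.find hx *
      (A (α (Nat.find hx)) ((fun t => c - (t - c) / s₂ c)^[Nat.find hx] x) - e)
  else e

variable {c e r : ℝ} {A : ι → ℝ → ℝ}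

theorem glue_of_mem (α : ℕ → ι) {x : ℝ} (hx : x ∈ dom c) : glue c e r A α x = A (α 0) x := by
  classical
  have hex : ∃ k : ℕ, (fun t => c - (t - c) / s₂ c)^[k] x ∈ dom c := ⟨0, hx⟩
  have h0 : Nat.find hex = 0 := (Nat.find_eq_zero hex).2 hx
  rw [glue, dif_pos hex, h0]
  simp

theorem glue_of_notMem (α : ℕ → ι) {x : ℝ} (hx : x ∉ dom c) :
    glue c e r A α x
      = e + r * (glue c e r A (fun k => α (k + 1)) (c - (x - c) / s₂ c) - e) := by
  classical
  by_cases hex : ∃ k : ℕ, (fun t => c - (t - c) / s₂ c)^[k] x ∈ dom c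
  · have hex' : ∃ k : ℕ, (fun t => c - (t - c) / s₂ c)^[k + 1] x ∈ dom c := by
      obtain ⟨k, hk⟩ := hex
      cases k with
      | zero => exact absurd hk hx
      | succ k => exact ⟨k, hk⟩
    have hex'' : ∃ k : ℕ, (fun t => c - (t - c) / s₂ c)^[k] (c - (x - c) / s₂ c) ∈ dom c := hex'
    have hf : Nat.find hex = Nat.find hex'' + 1 := Nat.find_comp_succ hex hex' hx
    rw [glue, dif_pos hex, glue, dif_pos hex'', hf, Function.iterate_succ_apply]
    ring
  · have hex'' : ¬ ∃ k : ℕ, (fun t => c - (t - c) / s₂ c)^[k] (c - (x - c) / s₂ c) ∈ dom c :=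
      fun ⟨k, hk⟩ => hex ⟨k + 1, hk⟩
    rw [glue, dif_neg hex, glue, dif_neg hex'']
    ring

theorem glue_F₁ (h : IsFixedParameter c) (h1 : ∀ i j, A i (u c 0) = e + r * (A j 1 - e))
    (h0 : ∀ i j, A i ((u c)^[4] 0) = e + r * (A j 0 - e)) (α : ℕ → ι) {w : ℝ}
    (hw : w ∈ Icc (0 : ℝ) 1) :
    glue c e r A α (F₁ c w) = e + r * (glue c e r A (fun k => α (k + 1)) w - e) := by
  by_cases hd : F₁ c w ∈ dom c
  · rcases h.eq_zero_or_one_of_F₁_mem_dom hw hd with rfl | rfl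
    · rw [glue_of_mem α hd, glue_of_mem _ h.zero_mem_dom, h.F₁_zero, h0]
    · rw [glue_of_mem α hd, glue_of_mem _ h.one_mem_dom, h.F₁_one, h1]
  · have hs := h.s₂_pos.ne'
    have : c - (F₁ c w - c) / s₂ c = w := by rw [h.F₁_eq]; field_simp; ring
    rw [glue_of_notMem α hd, this]

theorem glue_self (h : IsFixedParameter c) (α : ℕ → ι) : glue c e r A α c = e := by
  rw [glue, dif_neg]
  rintro ⟨k, hk⟩
  have : (fun t => c - (t - c) / s₂ c)^[k] c = c := Function.iterate_fixed (by simp) k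
  rw [this] at hk
  exact h.notMem_dom hk

theorem glue_F₁_iterate (h : IsFixedParameter c)
    (h1 : ∀ i j, A i (u c 0) = e + r * (A j 1 - e))
    (h0 : ∀ i j, A i ((u c)^[4] 0) = e + r * (A j 0 - e)) (k : ℕ) (α : ℕ → ι) {w : ℝ}
    (hw : w ∈ Icc (0 : ℝ) 1) :
    glue c e r A α ((F₁ c)^[k] w)
      = e + r ^ k * (glue c e r A (fun j => α (j + k)) w - e) := by
  induction k generalizing α w with
  | zero => simp
  | succ k ih =>
    rw [Function.iterate_succ_apply, ih α (h.F₁_mem_unit hw), glue_F₁ h h1 h0 _ hw]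
    simp only [add_right_comm _ 1 k, add_assoc]
    ring

/-- The two functions glued along sequences with a common beginning are close. -/
theorem dist_glue_le (h : IsFixedParameter c)
    (h1 : ∀ i j, A i (u c 0) = e + r * (A j 1 - e))
    (h0 : ∀ i j, A i ((u c)^[4] 0) = e + r * (A j 0 - e)) {B : ℝ}
    (hB : ∀ α, ∀ x ∈ Icc (0 : ℝ) 1, |glue c e r A α x - e| ≤ B) (k : ℕ) {α β : ℕ → ι}
    (hαβ : ∀ j < k, α j = β j) {x : ℝ} (hx : x ∈ Icc (0 : ℝ) 1) :
    |glue c e r A α x - glue c e r A β x| ≤ |r| ^ k * (2 * B) := by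
  induction k generalizing α β x with
  | zero =>
    have a1 := hB α x hx
    have a2 := hB β x hx
    rw [pow_zero, one_mul, abs_le]
    rw [abs_le] at a1 a2
    constructor <;> linarith
  | succ k ih =>
    have hB0 : 0 ≤ B := (abs_nonneg _).trans (hB α x hx)
    by_cases hJ : x ∈ Icc (u c 0) ((u c)^[4] 0)
    · obtain ⟨w, hw, rfl⟩ := h.mem_F₁_image hJ
      rw [glue_F₁ h h1 h0 _ hw, glue_F₁ h h1 h0 _ hw]
      have := ih (α := fun k => α (k + 1)) (β := fun k => β (k + 1))
        (fun j hj => hαβ _ (by omega)) hw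
      rw [show ∀ a b : ℝ, e + r * (a - e) - (e + r * (b - e)) = r * (a - b) from
        fun a b => by ring, abs_mul, pow_succ', mul_assoc]
      gcongr
    · have hd := IsFixedParameter.mem_dom_of_notMem hx hJ
      rw [glue_of_mem α hd, glue_of_mem β hd, hαβ 0 (by omega), sub_self, abs_zero]
      positivity

/-- A uniform bound near `c` of a glued function. -/
theorem glue_abs_sub_le (h : IsFixedParameter c)
    (h1 : ∀ i j, A i (u c 0) = e + r * (A j 1 - e))
    (h0 : ∀ i j, A i ((u c)^[4] 0) = e + r * (A j 0 - e)) {B : ℝ}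
    (hB : ∀ i, ∀ x ∈ dom c, |A i x - e| ≤ B) {m : ℕ} (hr : |r| = s₂ c ^ m) :
    ∃ M : ℝ, 0 ≤ M ∧ ∀ α, ∀ x ∈ Icc (0 : ℝ) 1, |glue c e r A α x - e| ≤ M * |x - c| ^ m := by
  set δ := min (c - u c 0) ((u c)^[4] 0 - c) with hδ
  have hδ0 : 0 < δ := lt_min (sub_pos.2 h.left_lt) (sub_pos.2 h.lt_right)
  have key : ∀ x ∈ dom c, δ ≤ |x - c| := by
    rintro x (hx | hx)
    · rw [abs_sub_comm]
      exact (min_le_left _ _).trans ((by linarith [hx.2] : c - u c 0 ≤ c - x).trans (le_abs_self _))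
    · exact (min_le_right _ _).trans
        ((by linarith [hx.1] : (u c)^[4] 0 - c ≤ x - c).trans (le_abs_self _))
  refine ⟨|B| / δ ^ m, by positivity, fun α x hx => ?_⟩
  by_cases hxc : x = c
  · subst hxc
    rw [glue_self h, sub_self, abs_zero]; positivity
  · revert α
    refine h.induction (P := fun x => ∀ α : ℕ → ι, |glue c e r A α x - e|
      ≤ |B| / δ ^ m * |x - c| ^ m) ?_ ?_ hx hxc
    · intro x hx hJ α
      have hd := IsFixedParameter.mem_dom_of_notMem hx hJ
      rw [glue_of_mem α hd, div_mul_eq_mul_div, le_div_iff₀ (by positivity)]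
      have := key x hd
      have hb := (hB (α 0) x hd).trans (le_abs_self B)
      gcongr
    · intro w hw ih α
      rw [glue_F₁ h h1 h0 _ hw, add_sub_cancel_left, abs_mul, hr, h.F₁_eq,
        show c - s₂ c * (w - c) - c = -(s₂ c * (w - c)) by ring, abs_neg, abs_mul,
        abs_of_pos h.s₂_pos, mul_pow, mul_left_comm]
      exact mul_le_mul_of_nonneg_left (ih _) (pow_nonneg h.s₂_pos.le m)

/-- Gluing Lipschitz functions with the factor of the rescaling in the domain gives a Lipschitz
function. -/
theorem lipschitzOnWith_glue (h : IsFixedParameter c)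
    (h1 : ∀ i j, A i (u c 0) = -s₂ c * A j 1) (h0 : ∀ i j, A i ((u c)^[4] 0) = -s₂ c * A j 0)
    {K : NNReal} (hK : ∀ i, LipschitzOnWith K (A i) (dom c)) {B : ℝ}
    (hB : ∀ i, ∀ x ∈ dom c, |A i x| ≤ B) :
    ∃ L : NNReal, ∀ α, LipschitzOnWith L (glue c 0 (-s₂ c) A α) (Icc 0 1) := by
  have h1' : ∀ i j, A i (u c 0) = 0 + -s₂ c * (A j 1 - 0) := by simpa using h1
  have h0' : ∀ i j, A i ((u c)^[4] 0) = 0 + -s₂ c * (A j 0 - 0) := by simpa using h0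
  have hs := h.s₂_pos
  obtain ⟨M, hM0, hM⟩ := glue_abs_sub_le (m := 1) h h1' h0' (by simpa using hB)
    (by rw [abs_neg, abs_of_pos hs, pow_one])
  simp only [sub_zero, pow_one] at hM
  have hdom : ∀ α : ℕ → ι, ∀ x ∈ dom c, ∀ y ∈ dom c,
      |glue c 0 (-s₂ c) A α x - glue c 0 (-s₂ c) A α y| ≤ K * |x - y| := by
    intro α x hx y hy
    rw [glue_of_mem α hx, glue_of_mem α hy]
    exact (hK (α 0)).dist_le_mul x hx y hy
  have hF : ∀ α : ℕ → ι, ∀ v ∈ Icc (0 : ℝ) 1, ∀ w ∈ Icc (0 : ℝ) 1,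
      |glue c 0 (-s₂ c) A (fun k => α (k + 1)) v - glue c 0 (-s₂ c) A (fun k => α (k + 1)) w|
        ≤ K * |v - w| →
      |glue c 0 (-s₂ c) A α (F₁ c v) - glue c 0 (-s₂ c) A α (F₁ c w)|
        ≤ K * |F₁ c v - F₁ c w| := by
    intro α v hv w hw hvw
    rw [glue_F₁ h h1' h0' _ hv, glue_F₁ h h1' h0' _ hw, h.F₁_eq, h.F₁_eq,
      show ∀ a b : ℝ, 0 + -s₂ c * (a - 0) - (0 + -s₂ c * (b - 0)) = -(s₂ c * (a - b)) from
        fun a b => by ring,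
      show c - s₂ c * (v - c) - (c - s₂ c * (w - c)) = -(s₂ c * (v - w)) by ring, abs_neg,
      abs_neg, abs_mul, abs_mul, abs_of_pos hs, mul_left_comm]
    exact mul_le_mul_of_nonneg_left hvw hs.le
  have side : ∀ y ∈ Icc (0 : ℝ) 1, y ≠ c → ∀ α : ℕ → ι, ∀ x ∈ Icc (0 : ℝ) 1,
      (x ≤ y ∧ y < c ∨ c < y ∧ y ≤ x) →
      |glue c 0 (-s₂ c) A α x - glue c 0 (-s₂ c) A α y| ≤ K * |x - y| := by
    intro y hy hyc
    refine h.induction (P := fun y => ∀ α : ℕ → ι, ∀ x ∈ Icc (0 : ℝ) 1,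
      (x ≤ y ∧ y < c ∨ c < y ∧ y ≤ x) →
      |glue c 0 (-s₂ c) A α x - glue c 0 (-s₂ c) A α y| ≤ K * |x - y|) ?_ ?_ hy hyc
    · intro y hy hJ α x hx hxy
      refine hdom α x (IsFixedParameter.mem_dom_of_notMem hx fun hxJ => hJ ?_) y
        (IsFixedParameter.mem_dom_of_notMem hy hJ)
      rcases hxy with hxy | hxy
      · exact ⟨hxJ.1.trans hxy.1, hxy.2.le.trans h.lt_right.le⟩
      · exact ⟨h.left_lt.le.trans hxy.1.le, hxy.2.trans hxJ.2⟩
    · intro w hw ih α x hx hxy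
      have hmono : ∀ v, F₁ c v = c + s₂ c * (c - v) := fun v => by rw [h.F₁_eq]; ring
      have hwc : ∀ v ∈ Icc (0 : ℝ) 1, (F₁ c v ≤ F₁ c w ∧ F₁ c w < c ∨
          c < F₁ c w ∧ F₁ c w ≤ F₁ c v) → (v ≤ w ∧ w < c ∨ c < w ∧ w ≤ v) := by
        intro v _ hvw
        rw [hmono, hmono] at hvw
        rcases hvw with ⟨e1, e2⟩ | ⟨e1, e2⟩
        · right
          exact ⟨by by_contra hc; nlinarith [mul_nonneg hs.le (sub_nonneg.2 (not_lt.1 hc))],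
            by by_contra hc; nlinarith [mul_pos hs (sub_pos.2 (not_le.1 hc))]⟩
        · left
          exact ⟨by by_contra hc; nlinarith [mul_pos hs (sub_pos.2 (not_le.1 hc))],
            by by_contra hc; nlinarith [mul_nonneg hs.le (sub_nonneg.2 (not_lt.1 hc))]⟩
      by_cases hxJ : x ∈ Icc (u c 0) ((u c)^[4] 0)
      · obtain ⟨v, hv, rfl⟩ := h.mem_F₁_image hxJ
        exact hF α v hv w hw (ih _ v hv (hwc v hv hxy))
      · have hxd := IsFixedParameter.mem_dom_of_notMem hx hxJ
        have hwJ := h.F₁_mem hw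
        -- pass through the end point of `F₁ [0,1]` between the two points
        have through : ∀ v ∈ Icc (0 : ℝ) 1, F₁ c v ∈ dom c →
            (x ≤ F₁ c v ∧ F₁ c v ≤ F₁ c w ∧ F₁ c w < c ∨
              c < F₁ c w ∧ F₁ c w ≤ F₁ c v ∧ F₁ c v ≤ x) →
            |glue c 0 (-s₂ c) A α x - glue c 0 (-s₂ c) A α (F₁ c w)| ≤ K * |x - F₁ c w| := by
          intro v hv hvd hvw
          have a1 := hdom α x hxd _ hvd
          have a2 := hF α v hv w hw (ih _ v hv (hwc v hv (by tauto)))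
          have a3 : |x - F₁ c v| + |F₁ c v - F₁ c w| = |x - F₁ c w| := by
            rcases hvw with ⟨e1, e2, -⟩ | ⟨-, e1, e2⟩
            · rw [abs_of_nonpos, abs_of_nonpos, abs_of_nonpos] <;> linarith
            · rw [abs_of_nonneg, abs_of_nonneg, abs_of_nonneg] <;> linarith
          rw [← a3, mul_add]
          exact (abs_sub_le _ (glue c 0 (-s₂ c) A α (F₁ c v)) _).trans (add_le_add a1 a2)
        rcases hxy with ⟨e1, e2⟩ | ⟨e1, e2⟩
        · refine through 1 (by simp) (h.F₁_one ▸ h.left_mem_dom) (Or.inl ⟨?_, ?_, e2⟩)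
          · rw [h.F₁_one]
            by_contra hc
            exact hxJ ⟨(not_le.1 hc).le, e1.trans hwJ.2⟩
          · rw [h.F₁_one]; exact hwJ.1
        · refine through 0 (by simp) (h.F₁_zero ▸ h.right_mem_dom) (Or.inr ⟨e1, ?_, ?_⟩)
          · rw [h.F₁_zero]; exact hwJ.2
          · rw [h.F₁_zero]
            by_contra hc
            exact hxJ ⟨hwJ.1.trans e2, (not_le.1 hc).le⟩
  have ordered : ∀ α : ℕ → ι, ∀ x ∈ Icc (0 : ℝ) 1, ∀ y ∈ Icc (0 : ℝ) 1, x ≤ y →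
      |glue c 0 (-s₂ c) A α x - glue c 0 (-s₂ c) A α y| ≤ (K + M) * |x - y| := by
    intro α x hx y hy hxy
    have hK0 : (K : ℝ) * |x - y| ≤ (K + M) * |x - y| := by gcongr; linarith
    rcases lt_or_ge y c with hyc | hyc
    · exact (side y hy hyc.ne α x hx (Or.inl ⟨hxy, hyc⟩)).trans hK0
    rcases lt_or_ge c x with hxc | hxc
    · rw [abs_sub_comm, abs_sub_comm x y] at *
      exact (side x hx hxc.ne' α y hy (Or.inr ⟨hxc, hxy⟩)).trans hK0
    · have a1 := hM α x hx
      have a2 := hM α y hy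
      have a3 : M * |x - c| + M * |y - c| = M * |x - y| := by
        rw [abs_of_nonpos (by linarith : x - c ≤ 0), abs_of_nonneg (by linarith : 0 ≤ y - c),
          abs_of_nonpos (by linarith : x - y ≤ 0)]
        ring
      have a4 : M * |x - y| ≤ (K + M) * |x - y| := by gcongr; linarith [K.2]
      exact (abs_sub _ _).trans (by linarith)
  refine ⟨K + ⟨M, hM0⟩, fun α => LipschitzOnWith.of_dist_le_mul fun x hx y hy => ?_⟩
  rw [Real.dist_eq, Real.dist_eq]
  change _ ≤ (K + M) * |x - y|
  rcases le_total x y with hxy | hxy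
  · exact ordered α x hx y hy hxy
  · rw [abs_sub_comm, abs_sub_comm x y]
    exact ordered α y hy x hx hxy

theorem isClosed_dom (c : ℝ) : IsClosed (dom c) := isClosed_Icc.union isClosed_Icc

/-- Gluing differentiable functions whose derivatives match. -/
theorem hasDerivWithinAt_glue (h : IsFixedParameter c) {A' : ι → ℝ → ℝ}
    (h1 : ∀ i j, A i (u c 0) = 1 + s₃ c * (A j 1 - 1))
    (h0 : ∀ i j, A i ((u c)^[4] 0) = 1 + s₃ c * (A j 0 - 1))
    (h1' : ∀ i j, A' i (u c 0) = 0 + -s₂ c * (A' j 1 - 0))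
    (h0' : ∀ i j, A' i ((u c)^[4] 0) = 0 + -s₂ c * (A' j 0 - 0))
    (hB : ∀ i, ∀ x ∈ dom c, A i x ∈ Icc (0 : ℝ) 1)
    (hA : ∀ i, ∀ x ∈ dom c, HasDerivWithinAt (A i) (A' i x) (dom c) x) (α : ℕ → ι) {x : ℝ}
    (hx : x ∈ Icc (0 : ℝ) 1) :
    HasDerivWithinAt (glue c 1 (s₃ c) A α) (glue c 0 (-s₂ c) A' α x) (Icc 0 1) x := by
  have hs := h.s₂_pos
  have cover : Icc (0 : ℝ) 1 ⊆ dom c ∪ Icc (u c 0) ((u c)^[4] 0) := fun x hx => by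
    by_cases hJ : x ∈ Icc (u c 0) ((u c)^[4] 0)
    · exact Or.inr hJ
    · exact Or.inl (IsFixedParameter.mem_dom_of_notMem hx hJ)
  have onDom : ∀ (α : ℕ → ι) (x : ℝ),
      HasDerivWithinAt (glue c 1 (s₃ c) A α) (glue c 0 (-s₂ c) A' α x) (dom c) x := by
    intro α x
    by_cases hx : x ∈ dom c
    · rw [glue_of_mem α hx]
      exact (hA (α 0) x hx).congr_of_mem (fun y hy => glue_of_mem α hy) hx
    · exact HasFDerivWithinAt.of_notMem_closure (by rwa [(isClosed_dom c).closure_eq])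
  by_cases hxc : x = c
  · subst hxc
    obtain ⟨M, hM0, hM⟩ := glue_abs_sub_le (m := 2) (B := 1) h h1 h0
      (fun i x hx => abs_le.2 ⟨by linarith [(hB i x hx).1], by linarith [(hB i x hx).2]⟩)
      (by rw [abs_of_pos h.s₃_pos, h.s₃_eq])
    rw [glue_self h, hasDerivWithinAt_iff_isLittleO]
    simp only [glue_self h, smul_zero, sub_zero]
    have : (fun y => glue x 1 (s₃ x) A α y - 1) =O[𝓝[Icc 0 1] x] fun y => (y - x) ^ 2 := by
      refine Asymptotics.IsBigO.of_bound M ?_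
      filter_upwards [self_mem_nhdsWithin] with y hy
      simpa using hM α y hy
    refine this.trans_isLittleO ?_
    have h2 : (fun y : ℝ => (y - x) ^ 2) =o[𝓝 x] fun y => y - x := by
      have := (Asymptotics.isLittleO_pow_id (𝕜 := ℝ) (n := 2) (by norm_num)).comp_tendsto
        (show Tendsto (fun y => y - x) (𝓝 x) (𝓝 0) by
          have : Continuous fun y : ℝ => y - x := by fun_prop
          simpa using this.tendsto x)
      exact this
    exact h2.mono nhdsWithin_le_nhds
  revert α
  refine h.induction (P := fun x => ∀ α : ℕ → ι, HasDerivWithinAt (glue c 1 (s₃ c) A α)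
    (glue c 0 (-s₂ c) A' α x) (Icc 0 1) x) ?_ ?_ hx hxc
  · intro x hx hJ α
    refine HasDerivWithinAt.mono ((onDom α x).union ?_) cover
    exact HasFDerivWithinAt.of_notMem_closure (by rwa [isClosed_Icc.closure_eq])
  · intro w hw ih α
    refine HasDerivWithinAt.mono ((onDom α _).union ?_) cover
    set G : ℝ → ℝ := fun t => c - (t - c) / s₂ c with hG
    have hGF : ∀ w, G (F₁ c w) = w := fun w => by
      simp only [hG]; rw [h.F₁_eq]; field_simp; ring
    have dG : HasDerivWithinAt G (-(1 / s₂ c)) (Icc (u c 0) ((u c)^[4] 0)) (F₁ c w) :=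
      ((((hasDerivAt_id (F₁ c w)).sub_const c).div_const (s₂ c)).const_sub c).hasDerivWithinAt
    have mG : MapsTo G (Icc (u c 0) ((u c)^[4] 0)) (Icc 0 1) := fun t ht => by
      obtain ⟨v, hv, rfl⟩ := h.mem_F₁_image ht
      rwa [hGF]
    have hw' := ih fun k => α (k + 1)
    rw [← hGF w] at hw'
    have := (((hw'.comp (F₁ c w) dG mG).sub_const 1).const_mul (s₃ c)).const_add 1
    refine (this.congr_of_mem (fun t ht => ?_) (h.F₁_mem hw)).congr_deriv ?_
    · obtain ⟨v, hv, rfl⟩ := h.mem_F₁_image ht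
      rw [glue_F₁ h h1 h0 _ hv, Function.comp, hGF]
    · rw [hGF, glue_F₁ h h1' h0' _ hw, h.s₃_eq]
      field_simp
      ring

end Glue

/-! ### Extensions of the piecewise affine map -/

namespace IsFixedParameter

variable {c : ℝ}

theorem chord_zero_s₁ (h : IsFixedParameter c) (x : ℝ) :
    chord (u c) 0 (s₁ c) x = u c 0 + s₂ c / s₁ c * x := by
  rw [chord, slope_def_field, h.u_s₁, sub_zero, sub_zero]; rfl

theorem chord_s₃_one (h : IsFixedParameter c) (x : ℝ) :
    chord (u c) (1 - s₃ c) 1 x = s₁ c / s₃ c * (1 - x) := by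
  have := h.s₃_pos.ne'
  rw [chord, slope_def_field, h.u_one_sub, h.u_one, sub_sub_cancel]
  field_simp; ring

theorem chord_F₁ (h : IsFixedParameter c) {a b : ℝ} (hab : a ≠ b) (x : ℝ) :
    chord (u c) (F₁ c a) (F₁ c b) (F₁ c x) = F₂ c (chord (u c) a b x) := by
  have h1 := h.s₂_pos.ne'
  have h2 : b - a ≠ 0 := sub_ne_zero.2 hab.symm
  rw [chord, chord, slope_def_field, slope_def_field, h.u_F₁', h.u_F₁', h.F₁_eq, h.F₁_eq,
    h.F₁_eq, F₂, F₂, F₂,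
    show c - s₂ c * (b - c) - (c - s₂ c * (a - c)) = -(s₂ c * (b - a)) by ring]
  field_simp; ring

theorem slope_F₁ (h : IsFixedParameter c) {a b : ℝ} (hab : a ≠ b) :
    _root_.slope (u c) (F₁ c a) (F₁ c b) = -s₂ c * _root_.slope (u c) a b := by
  have h1 := h.s₂_pos.ne'
  have h2 : b - a ≠ 0 := sub_ne_zero.2 hab.symm
  rw [slope_def_field, slope_def_field, h.u_F₁, h.u_F₁, h.F₁_eq, h.F₁_eq,
    show c - s₂ c * (b - c) - (c - s₂ c * (a - c)) = -(s₂ c * (b - a)) by ring]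
  field_simp; ring

theorem F₁_injective (h : IsFixedParameter c) : Function.Injective (F₁ c) := fun a b hab => by
  rw [h.F₁_eq, h.F₁_eq] at hab
  exact sub_left_injective (mul_left_cancel₀ h.s₂_pos.ne' (sub_right_injective hab))

theorem slope_zero_s₁ (h : IsFixedParameter c) :
    _root_.slope (u c) 0 (s₁ c) = s₂ c / s₁ c := by
  rw [slope_def_field, h.u_s₁, sub_zero]; rfl

theorem slope_s₃_one (h : IsFixedParameter c) :
    _root_.slope (u c) (1 - s₃ c) 1 = -(s₁ c / s₃ c) := by
  rw [slope_def_field, h.u_one_sub, h.u_one, sub_sub_cancel, zero_sub, neg_div]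

theorem slope_F₁_left (h : IsFixedParameter c) :
    _root_.slope (u c) (F₁ c (1 - s₃ c)) (F₁ c 1) = -s₂ c * -(s₁ c / s₃ c) := by
  rw [h.slope_F₁ (by linarith [h.s₃_pos]), h.slope_s₃_one]

theorem slope_F₁_right (h : IsFixedParameter c) :
    _root_.slope (u c) (F₁ c 0) (F₁ c (s₁ c)) = -s₂ c * (s₂ c / s₁ c) := by
  rw [h.slope_F₁ h.s₁_pos.ne, h.slope_zero_s₁]

end IsFixedParameter

namespace IsExtension

variable {c : ℝ} {ψ : ℝ → ℝ}

theorem eq_left (hψ : IsExtension c ψ) (h : IsFixedParameter c) {x : ℝ} (hx : x ∈ Icc 0 (s₁ c)) :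
    ψ x = u c 0 + s₂ c / s₁ c * x := by
  rw [← h.chord_zero_s₁]
  exact (hψ.extends_affine 0).1
    ⟨Or.inl ⟨hx.1, hx.2.trans h.s₁_lt.le⟩, by simpa using hx⟩

theorem eq_right (hψ : IsExtension c ψ) (h : IsFixedParameter c) {x : ℝ}
    (hx : x ∈ Icc (1 - s₃ c) 1) : ψ x = s₁ c / s₃ c * (1 - x) := by
  rw [← h.chord_s₃_one]
  exact (hψ.extends_affine 0).2
    ⟨Or.inr ⟨h.right_lt.le.trans hx.1, hx.2⟩, by simpa using hx⟩

theorem apply_zero (hψ : IsExtension c ψ) (h : IsFixedParameter c) : ψ 0 = u c 0 := by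
  rw [hψ.eq_left h ⟨le_rfl, h.s₁_pos.le⟩]; simp

theorem apply_one (hψ : IsExtension c ψ) (h : IsFixedParameter c) : ψ 1 = 0 := by
  rw [hψ.eq_right h ⟨by linarith [h.s₃_pos], le_rfl⟩]; simp

theorem apply_left (hψ : IsExtension c ψ) (h : IsFixedParameter c) : ψ (u c 0) = 1 - s₃ c := by
  have hs := h.s₃_pos
  have := (hψ.extends_affine 1).2 ⟨h.left_mem_dom, 1, ⟨by linarith, le_rfl⟩, by simp [h.F₁_one]⟩
  simp only [Function.iterate_one] at this
  rw [this]
  conv_lhs => rw [← h.F₁_one]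
  rw [h.chord_F₁ (by linarith), h.chord_s₃_one, F₂]; ring

theorem apply_right (hψ : IsExtension c ψ) (h : IsFixedParameter c) :
    ψ ((u c)^[4] 0) = 1 - s₃ c * (1 - u c 0) := by
  have := (hψ.extends_affine 1).1 ⟨h.right_mem_dom, 0, ⟨le_rfl, h.s₁_pos.le⟩, by simp [h.F₁_zero]⟩
  simp only [Function.iterate_one] at this
  rw [this]
  conv_lhs => rw [← h.F₁_zero]
  rw [h.chord_F₁ h.s₁_pos.ne, h.chord_zero_s₁, F₂]; ring

/-- A Lipschitz derivative of an extension. -/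
noncomputable def deriv' (hψ : IsExtension c ψ) : ℝ → ℝ := hψ.c1_lip.choose

theorem hasDerivWithinAt (hψ : IsExtension c ψ) {x : ℝ} (hx : x ∈ dom c) :
    HasDerivWithinAt ψ (hψ.deriv' x) (dom c) x := hψ.c1_lip.choose_spec.1 x hx

theorem lipschitz_deriv' (hψ : IsExtension c ψ) : ∃ K, LipschitzOnWith K hψ.deriv' (dom c) :=
  hψ.c1_lip.choose_spec.2.1

theorem deriv'_ne_zero (hψ : IsExtension c ψ) {x : ℝ} (hx : x ∈ dom c) : hψ.deriv' x ≠ 0 :=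
  hψ.c1_lip.choose_spec.2.2.1 x hx

theorem deriv'_zero (hψ : IsExtension c ψ) (h : IsFixedParameter c) :
    hψ.deriv' 0 = s₂ c / s₁ c := by
  have hs := h.s₁_pos
  have h0 : (0 : ℝ) ∈ Icc 0 (s₁ c) := ⟨le_rfl, hs.le⟩
  have h1 := (hψ.hasDerivWithinAt h.zero_mem_dom).mono
    (show Icc 0 (s₁ c) ⊆ dom c from fun x hx => Or.inl ⟨hx.1, hx.2.trans h.s₁_lt.le⟩)
  have h2 : HasDerivWithinAt ψ (s₂ c / s₁ c) (Icc 0 (s₁ c)) 0 := by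
    have := (((hasDerivAt_id (0 : ℝ)).const_mul (s₂ c / s₁ c)).const_add (u c 0))
    refine (this.hasDerivWithinAt.congr_of_mem (fun x hx => hψ.eq_left h hx) h0).congr_deriv ?_
    simp
  exact (uniqueDiffOn_Icc hs 0 h0).eq_deriv _ h1 h2

theorem deriv'_one (hψ : IsExtension c ψ) (h : IsFixedParameter c) :
    hψ.deriv' 1 = -(s₁ c / s₃ c) := by
  have hs : 1 - s₃ c < 1 := by linarith [h.s₃_pos]
  have h0 : (1 : ℝ) ∈ Icc (1 - s₃ c) 1 := ⟨hs.le, le_rfl⟩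
  have h1 := (hψ.hasDerivWithinAt h.one_mem_dom).mono
    (show Icc (1 - s₃ c) 1 ⊆ dom c from fun x hx => Or.inr ⟨h.right_lt.le.trans hx.1, hx.2⟩)
  have h2 : HasDerivWithinAt ψ (-(s₁ c / s₃ c)) (Icc (1 - s₃ c) 1) 1 := by
    have := (((hasDerivAt_id (1 : ℝ)).const_sub 1).const_mul (s₁ c / s₃ c))
    refine (this.hasDerivWithinAt.congr_of_mem (fun x hx => hψ.eq_right h hx) h0).congr_deriv ?_
    simp
  exact (uniqueDiffOn_Icc hs 1 h0).eq_deriv _ h1 h2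

theorem deriv'_left (hψ : IsExtension c ψ) (h : IsFixedParameter c) :
    hψ.deriv' (u c 0) = -s₂ c * -(s₁ c / s₃ c) := by
  have : hψ.deriv' (F₁ c 1) = _ := hψ.c1_lip.choose_spec.2.2.2.1
  rwa [h.slope_F₁_left, h.F₁_one] at this

theorem deriv'_right (hψ : IsExtension c ψ) (h : IsFixedParameter c) :
    hψ.deriv' ((u c)^[4] 0) = -s₂ c * (s₂ c / s₁ c) := by
  have : hψ.deriv' (F₁ c 0) = _ := hψ.c1_lip.choose_spec.2.2.2.2
  rwa [h.slope_F₁_right, h.F₁_zero] at this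

end IsExtension

/-! ### The family of unimodal maps -/

theorem C1LipUnimodal.ext_toMap {f g : C1LipUnimodal} (hfg : ∀ x, f x = g x) : f = g := by
  have h1 : f.toMap = g.toMap := ContinuousMap.ext hfg
  have h2 : f.slope = g.slope := by
    ext x
    have := f.hasDeriv x
    rw [h1] at this
    exact (uniqueDiffOn_Icc (zero_lt_one' ℝ) x x.2).eq_deriv _ this (g.hasDeriv x)
  have h3 : f.crit = g.crit := by
    rw [← g.slope_eq_zero_iff, ← h2, f.slope_eq_zero_iff]
  cases f; cases g
  simp only at h1 h2 h3
  subst h1 h2 h3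
  rfl

theorem uniformContinuous_toMap_slope :
    UniformContinuous fun f : C1LipUnimodal => (f.toMap, f.slope) := uniformContinuous_comap

theorem uniformContinuous_toMap : UniformContinuous fun f : C1LipUnimodal => f.toMap := by
  have h : UniformContinuous (Prod.fst ∘ fun f : C1LipUnimodal => (f.toMap, f.slope)) :=
    uniformContinuous_fst.comp uniformContinuous_toMap_slope
  exact h

instance : T2Space C1LipUnimodal :=
  T2Space.of_injective_continuous (f := fun f : C1LipUnimodal => (f.toMap, f.slope))
    (fun _ _ hfg => C1LipUnimodal.ext_toMap fun x => DFunLike.congr_fun (Prod.ext_iff.1 hfg).1 x)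
    uniformContinuous_toMap_slope.continuous

/-- A map from a sequence space is continuous if sequences with a long common beginning have
close values. -/
theorem continuous_of_common_beginning {ι X : Type*} [TopologicalSpace ι] [DiscreteTopology ι]
    [PseudoMetricSpace X] {g : (ℕ → ι) → X} {r B : ℝ}
    (hr0 : 0 ≤ r) (hr : r < 1)
    (hg : ∀ k α β, (∀ j < k, α j = β j) → dist (g α) (g β) ≤ r ^ k * B) : Continuous g := by
  rw [continuous_iff_continuousAt]
  intro α
  rw [ContinuousAt, Metric.tendsto_nhds]
  intro ε hε
  have hlim : Tendsto (fun k => r ^ k * B) atTop (𝓝 0) := by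
    simpa using (tendsto_pow_atTop_nhds_zero_of_lt_one hr0 hr).mul_const B
  obtain ⟨k, hk⟩ := (hlim.eventually (gt_mem_nhds hε)).exists
  have : ∀ᶠ β in 𝓝 α, ∀ j ∈ Finset.range k, β j = α j := by
    rw [Filter.eventually_all_finset]
    intro j _
    exact (continuous_apply j).continuousAt.eventually (discreteTopology_iff_singleton_mem_nhds.1 ‹_› _)
  filter_upwards [this] with β hβ
  exact (hg k β α fun j hj => hβ j (Finset.mem_range.2 hj)).trans_lt hk

section Family

variable {c : ℝ} {ι : Type*} {ψ : ι → ℝ → ℝ}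

/-- The glued map. -/
noncomputable def glueMap (c : ℝ) (ψ : ι → ℝ → ℝ) : (ℕ → ι) → ℝ → ℝ := glue c 1 (s₃ c) ψ

/-- The derivative of the glued map. -/
noncomputable def glueSlope (hψ : ∀ i, IsExtension c (ψ i)) : (ℕ → ι) → ℝ → ℝ :=
  glue c 0 (-s₂ c) fun i => (hψ i).deriv'

theorem match_left (h : IsFixedParameter c) (hψ : ∀ i, IsExtension c (ψ i)) (i j : ι) :
    ψ i (u c 0) = 1 + s₃ c * (ψ j 1 - 1) := by
  rw [(hψ i).apply_left h, (hψ j).apply_one h]; ring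

theorem match_right (h : IsFixedParameter c) (hψ : ∀ i, IsExtension c (ψ i)) (i j : ι) :
    ψ i ((u c)^[4] 0) = 1 + s₃ c * (ψ j 0 - 1) := by
  rw [(hψ i).apply_right h, (hψ j).apply_zero h]; ring

theorem match_slope_left (h : IsFixedParameter c) (hψ : ∀ i, IsExtension c (ψ i)) (i j : ι) :
    (hψ i).deriv' (u c 0) = 0 + -s₂ c * ((hψ j).deriv' 1 - 0) := by
  rw [(hψ i).deriv'_left h, (hψ j).deriv'_one h]; ring

theorem match_slope_right (h : IsFixedParameter c) (hψ : ∀ i, IsExtension c (ψ i)) (i j : ι) :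
    (hψ i).deriv' ((u c)^[4] 0) = 0 + -s₂ c * ((hψ j).deriv' 0 - 0) := by
  rw [(hψ i).deriv'_right h, (hψ j).deriv'_zero h]; ring

theorem glueMap_of_mem (α : ℕ → ι) {x : ℝ} (hx : x ∈ dom c) : glueMap c ψ α x = ψ (α 0) x :=
  glue_of_mem α hx

theorem glueMap_F₁ (h : IsFixedParameter c) (hψ : ∀ i, IsExtension c (ψ i)) (α : ℕ → ι) {w : ℝ}
    (hw : w ∈ Icc (0 : ℝ) 1) :
    glueMap c ψ α (F₁ c w) = F₂ c (glueMap c ψ (fun k => α (k + 1)) w) := by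
  rw [glueMap, glue_F₁ h (match_left h hψ) (match_right h hψ) α hw, F₂]; ring

theorem glueMap_F₁_iterate (h : IsFixedParameter c) (hψ : ∀ i, IsExtension c (ψ i)) (k : ℕ)
    (α : ℕ → ι) {w : ℝ} (hw : w ∈ Icc (0 : ℝ) 1) :
    glueMap c ψ α ((F₁ c)^[k] w) = (F₂ c)^[k] (glueMap c ψ (fun j => α (j + k)) w) := by
  rw [glueMap, glue_F₁_iterate h (match_left h hψ) (match_right h hψ) k α hw,
    IsFixedParameter.F₂_iterate]; ring

theorem glueMap_mem (h : IsFixedParameter c) (hψ : ∀ i, IsExtension c (ψ i)) (α : ℕ → ι) {x : ℝ}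
    (hx : x ∈ Icc (0 : ℝ) 1) : glueMap c ψ α x ∈ Icc (0 : ℝ) 1 := by
  by_cases hxc : x = c
  · subst hxc; rw [glueMap, glue_self h]; simp
  revert α
  refine h.induction (P := fun x => ∀ α, glueMap c ψ α x ∈ Icc (0 : ℝ) 1) ?_ ?_ hx hxc
  · intro x hx hJ α
    have hd := IsFixedParameter.mem_dom_of_notMem hx hJ
    rw [glueMap_of_mem α hd]
    exact (hψ _).mapsTo hd
  · intro w hw ih α
    rw [glueMap_F₁ h hψ α hw, F₂]
    have := ih fun k => α (k + 1)
    have h3 := h.s₃_pos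
    have h4 := h.s₃_lt_one
    constructor <;> nlinarith [mul_nonneg h3.le this.1, mul_nonneg h3.le (sub_nonneg.2 this.2)]

theorem glueMap_hasDerivWithinAt (h : IsFixedParameter c) (hψ : ∀ i, IsExtension c (ψ i))
    (α : ℕ → ι) {x : ℝ} (hx : x ∈ Icc (0 : ℝ) 1) :
    HasDerivWithinAt (glueMap c ψ α) (glueSlope hψ α x) (Icc 0 1) x :=
  hasDerivWithinAt_glue h (match_left h hψ) (match_right h hψ) (match_slope_left h hψ)
    (match_slope_right h hψ) (fun i _ hx => (hψ i).mapsTo hx)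
    (fun i _ hx => (hψ i).hasDerivWithinAt hx) α hx

theorem exists_lipschitzOnWith_glueSlope [Finite ι] (h : IsFixedParameter c)
    (hψ : ∀ i, IsExtension c (ψ i)) :
    ∃ K : NNReal, ∀ α, LipschitzOnWith K (glueSlope hψ α) (Icc 0 1) := by
  choose K hK using fun i => (hψ i).lipschitz_deriv'
  obtain ⟨K', hK'⟩ := Finite.exists_le K
  refine lipschitzOnWith_glue h (by simpa using match_slope_left h hψ)
    (by simpa using match_slope_right h hψ) (fun i => (hK i).weaken (hK' i))
    (B := s₂ c / s₁ c + K') fun i x hx => ?_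
  have h1 := ((hK i).weaken (hK' i)).dist_le_mul x hx 0 h.zero_mem_dom
  rw [(hψ i).deriv'_zero h, Real.dist_eq, Real.dist_eq, sub_zero] at h1
  have hx' := h.dom_subset hx
  have h2 : (K' : ℝ) * |x| ≤ K' * 1 := by
    gcongr; rw [abs_of_nonneg hx'.1]; exact hx'.2
  have h3 : 0 < s₂ c / s₁ c := div_pos h.s₂_pos h.s₁_pos
  rw [abs_le] at h1 ⊢
  constructor <;> linarith

theorem glueSlope_eq_zero_iff (h : IsFixedParameter c) (hψ : ∀ i, IsExtension c (ψ i))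
    (α : ℕ → ι) {x : ℝ} (hx : x ∈ Icc (0 : ℝ) 1) : glueSlope hψ α x = 0 ↔ x = c := by
  constructor
  · contrapose
    intro hxc
    revert α
    refine h.induction (P := fun x => ∀ α, glueSlope hψ α x ≠ 0) ?_ ?_ hx hxc
    · intro x hx hJ α
      have hd := IsFixedParameter.mem_dom_of_notMem hx hJ
      rw [glueSlope, glue_of_mem α hd]
      exact (hψ _).deriv'_ne_zero hd
    · intro w hw ih α
      rw [glueSlope, glue_F₁ h (match_slope_left h hψ) (match_slope_right h hψ) α hw, zero_add,
        sub_zero]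
      exact mul_ne_zero (neg_ne_zero.2 h.s₂_pos.ne') (ih _)
  · rintro rfl
    exact glue_self h α

variable [Finite ι]

/-- The family of unimodal maps determined by finitely many extensions. -/
noncomputable def family (h : IsFixedParameter c) (hψ : ∀ i, IsExtension c (ψ i)) (α : ℕ → ι) :
    C1LipUnimodal where
  toMap := ⟨fun x => ⟨glueMap c ψ α x, glueMap_mem h hψ α x.2⟩, by
    have : ContinuousOn (glueMap c ψ α) (Icc 0 1) := fun x hx =>
      (glueMap_hasDerivWithinAt h hψ α hx).continuousWithinAt
    exact (continuousOn_iff_continuous_domRestrict.1 this).subtype_mk _⟩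
  slope := ⟨fun x => glueSlope hψ α x, by
    obtain ⟨K, hK⟩ := exists_lipschitzOnWith_glueSlope h hψ
    exact continuousOn_iff_continuous_domRestrict.1 (hK α).continuousOn⟩
  crit := ⟨c, h.pos.le, h.lt_one.le⟩
  hasDeriv := fun x => by
    refine (glueMap_hasDerivWithinAt h hψ α x.2).congr_of_mem (fun t ht => ?_) x.2
    rw [projIcc_of_mem zero_le_one ht]; rfl
  lip := by
    obtain ⟨K, hK⟩ := exists_lipschitzOnWith_glueSlope h hψ
    exact ⟨K, LipschitzWith.of_dist_le_mul fun x y => (hK α).dist_le_mul x x.2 y y.2⟩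
  slope_eq_zero_iff := fun x => by
    simp only [ContinuousMap.coe_mk, Subtype.ext_iff]
    exact glueSlope_eq_zero_iff h hψ α x.2
  crit_pos := Subtype.mk_lt_mk.2 h.pos
  crit_lt_one := Subtype.mk_lt_mk.2 h.lt_one
  map_crit := Subtype.ext (glue_self h α)
  map_one := Subtype.ext ((glueMap_of_mem α h.one_mem_dom).trans ((hψ _).apply_one h))

theorem coe_family (h : IsFixedParameter c) (hψ : ∀ i, IsExtension c (ψ i)) (α : ℕ → ι)
    (x : unitInterval) : (family h hψ α x : ℝ) = glueMap c ψ α x := rfl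

theorem family_crit (h : IsFixedParameter c) (hψ : ∀ i, IsExtension c (ψ i)) (α : ℕ → ι) :
    ((family h hψ α).crit : ℝ) = c := rfl

theorem graph_family (h : IsFixedParameter c) (hψ : ∀ i, IsExtension c (ψ i)) (α : ℕ → ι) :
    (family h hψ α).graph = insert (c, 1) (⋃ k : ℕ, (F c)^[k] '' graphOn c (ψ (α k))) := by
  have hF : ∀ k (p : ℝ × ℝ), (F c)^[k] p = ((F₁ c)^[k] p.1, (F₂ c)^[k] p.2) := by
    intro k
    induction k with
    | zero => intro p; rfl
    | succ k ih => intro p; simp only [Function.iterate_succ_apply, ih]; rfl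
  apply Subset.antisymm
  · rintro _ ⟨⟨x, hx⟩, rfl⟩
    simp only [coe_family]
    by_cases hxc : x = c
    · subst hxc
      left; rw [glueMap, glue_self h]
    · right
      revert α
      refine h.induction (P := fun x => ∀ α : ℕ → ι,
        (x, glueMap c ψ α x) ∈ ⋃ k : ℕ, (F c)^[k] '' graphOn c (ψ (α k))) ?_ ?_ hx hxc
      · intro x hx hJ α
        have hd := IsFixedParameter.mem_dom_of_notMem hx hJ
        exact mem_iUnion.2 ⟨0, (x, glueMap c ψ α x), ⟨hd, glueMap_of_mem α hd⟩, rfl⟩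
      · intro w hw ih α
        obtain ⟨k, p, hp, he⟩ := mem_iUnion.1 (ih fun k => α (k + 1))
        refine mem_iUnion.2 ⟨k + 1, p, hp, ?_⟩
        rw [Function.iterate_succ_apply', he, glueMap_F₁ h hψ α hw]; rfl
  · rintro p (rfl | hp)
    · exact ⟨⟨c, h.pos.le, h.lt_one.le⟩, by simp [coe_family, glueMap, glue_self h]⟩
    · obtain ⟨k, ⟨x, y⟩, ⟨hx, hy⟩, rfl⟩ := mem_iUnion.1 hp
      simp only at hx hy
      have hx1 := h.dom_subset hx
      have hk : (F₁ c)^[k] x ∈ Icc (0 : ℝ) 1 := by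
        clear hp hx hy
        induction k with
        | zero => exact hx1
        | succ k ih => rw [Function.iterate_succ_apply']; exact h.F₁_mem_unit ih
      refine ⟨⟨_, hk⟩, ?_⟩
      simp only [coe_family]
      rw [hF, glueMap_F₁_iterate h hψ k α hx1, glueMap_of_mem _ hx, hy]
      simp

theorem extendsOn_family (h : IsFixedParameter c) (hψ : ∀ i, IsExtension c (ψ i)) (α : ℕ → ι) :
    ExtendsOn c (fun x => (family h hψ α (projIcc 0 1 zero_le_one x) : ℝ)) (Icc 0 1) := by
  have hchord : ∀ (n : ℕ) (a b x : ℝ), a ≠ b →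
      chord (u c) ((F₁ c)^[n] a) ((F₁ c)^[n] b) ((F₁ c)^[n] x) = (F₂ c)^[n] (chord (u c) a b x) := by
    intro n a b x hab
    induction n with
    | zero => rfl
    | succ n ih =>
      simp only [Function.iterate_succ_apply']
      rw [h.chord_F₁ ((h.F₁_injective.iterate n).ne hab), ih]
  intro n
  constructor
  · rintro _ ⟨hx, w, hw, rfl⟩
    have hwd : w ∈ dom c := Or.inl ⟨hw.1, hw.2.trans h.s₁_lt.le⟩
    simp only [projIcc_of_mem zero_le_one hx, coe_family]
    rw [glueMap_F₁_iterate h hψ n α (h.dom_subset hwd), glueMap_of_mem _ hwd,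
      hchord n _ _ _ h.s₁_pos.ne, (hψ _).eq_left h hw, h.chord_zero_s₁]
  · rintro _ ⟨hx, w, hw, rfl⟩
    have hwd : w ∈ dom c := Or.inr ⟨h.right_lt.le.trans hw.1, hw.2⟩
    simp only [projIcc_of_mem zero_le_one hx, coe_family]
    rw [glueMap_F₁_iterate h hψ n α (h.dom_subset hwd), glueMap_of_mem _ hwd,
      hchord n _ _ _ (by linarith [h.s₃_pos]), (hψ _).eq_right h hw, h.chord_s₃_one]

theorem quadraticTip_family (h : IsFixedParameter c) (hψ : ∀ i, IsExtension c (ψ i))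
    (α : ℕ → ι) : QuadraticTip (family h hψ α) := by
  have hs := h.s₂_pos
  have hc := h.pos
  have hmem : ∀ k, (F₁ c)^[k] 0 ∈ Icc (0 : ℝ) 1 := by
    intro k
    induction k with
    | zero => simp
    | succ k ih => rw [Function.iterate_succ_apply']; exact h.F₁_mem_unit ih
  refine ⟨fun k => ⟨_, hmem k⟩, (1 - u c 0) / c ^ 2, ?_, ?_, ?_, ?_⟩
  · have : 0 < 1 - u c 0 := by linarith [h.left_lt, h.lt_one]
    positivity
  · intro k hk
    have := congrArg Subtype.val hk
    rw [family_crit] at this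
    simp only [h.F₁_iterate] at this
    have h2 : (-s₂ c) ^ k ≠ 0 := pow_ne_zero _ (neg_ne_zero.2 hs.ne')
    have h3 : (-s₂ c) ^ k * (0 - c) = 0 := by linarith
    rcases mul_eq_zero.1 h3 with h4 | h4
    · exact h2 h4
    · linarith
  · rw [tendsto_subtype_rng]
    simp only [family_crit, h.F₁_iterate]
    have := (tendsto_pow_atTop_nhds_zero_of_abs_lt_one (r := -s₂ c)
      (by rw [abs_neg, abs_of_pos hs]; exact h.s₂_lt_one)).mul_const (0 - c)
    simpa using this.const_add c
  · refine tendsto_const_nhds.congr fun k => ?_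
    rw [coe_family, (family h hψ α).map_crit, family_crit]
    rw [glueMap_F₁_iterate h hψ k α (show (0 : ℝ) ∈ Icc (0 : ℝ) 1 by simp),
      glueMap_of_mem _ h.zero_mem_dom, (hψ _).apply_zero h, IsFixedParameter.F₂_iterate, h.s₃_eq]
    simp only [h.F₁_iterate]
    have e : (c + (-s₂ c) ^ k * (0 - c) - c) ^ 2 = (s₂ c ^ 2) ^ k * c ^ 2 := by
      rw [show (s₂ c ^ 2) ^ k = ((-s₂ c) ^ k) ^ 2 by rw [← pow_mul, ← pow_mul, mul_comm k, pow_mul, pow_mul, neg_sq]]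
      ring
    rw [e, Icc.coe_one]
    have : (s₂ c ^ 2) ^ k ≠ 0 := by positivity
    field_simp
    ring

/-! ### Renormalization of the family -/

theorem coe_left_family (h : IsFixedParameter c) (hψ : ∀ i, IsExtension c (ψ i)) (α : ℕ → ι) :
    (left (family h hψ α) : ℝ) = u c 0 := by
  rw [left, coe_family, Icc.coe_zero, glueMap_of_mem _ h.zero_mem_dom,
    (hψ _).apply_zero h]

/-- The image of the renormalization interval under `f`. -/
theorem family_F₁ (h : IsFixedParameter c) (hψ : ∀ i, IsExtension c (ψ i)) (α : ℕ → ι)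
    {x t : unitInterval} (hx : (x : ℝ) = F₁ c t) :
    (family h hψ α x : ℝ) = 1 - s₃ c * (1 - family h hψ (fun k => α (k + 1)) t) := by
  rw [coe_family, hx, glueMap_F₁ h hψ α t.2, F₂, coe_family]

theorem family_of_mem_right (h : IsFixedParameter c) (hψ : ∀ i, IsExtension c (ψ i)) (α : ℕ → ι)
    {x : unitInterval} (hx : (x : ℝ) ∈ Icc (1 - s₃ c) 1) :
    (family h hψ α x : ℝ) = s₁ c / s₃ c * (1 - x) := by
  rw [coe_family, glueMap_of_mem _ (Or.inr ⟨h.right_lt.le.trans hx.1, hx.2⟩),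
    (hψ _).eq_right h hx]

theorem family_of_mem_left (h : IsFixedParameter c) (hψ : ∀ i, IsExtension c (ψ i)) (α : ℕ → ι)
    {x : unitInterval} (hx : (x : ℝ) ∈ Icc 0 (s₁ c)) :
    (family h hψ α x : ℝ) = u c 0 + s₂ c / s₁ c * x := by
  rw [coe_family, glueMap_of_mem _ (Or.inl ⟨hx.1, hx.2.trans h.s₁_lt.le⟩), (hψ _).eq_left h hx]

theorem one_sub_mem (h : IsFixedParameter c) (t : unitInterval) :
    1 - s₃ c * (1 - (t : ℝ)) ∈ Icc (1 - s₃ c) 1 := by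
  have := h.s₃_pos
  constructor <;> nlinarith [mul_nonneg this.le t.2.1, mul_nonneg this.le (sub_nonneg.2 t.2.2)]

theorem family_iterate_two (h : IsFixedParameter c) (hψ : ∀ i, IsExtension c (ψ i)) (α : ℕ → ι)
    {x t : unitInterval} (hx : (x : ℝ) = F₁ c t) :
    ((family h hψ α)^[2] x : ℝ) = s₁ c * (1 - family h hψ (fun k => α (k + 1)) t) := by
  have h1 := family_F₁ h hψ α hx
  have h3 := h.s₃_pos.ne'
  change (family h hψ α (family h hψ α x) : ℝ) = _
  rw [family_of_mem_right h hψ α (h1 ▸ one_sub_mem h _), h1]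
  field_simp; ring

theorem s₁_mul_mem (h : IsFixedParameter c) (t : unitInterval) :
    s₁ c * (1 - (t : ℝ)) ∈ Icc 0 (s₁ c) := by
  have := h.s₁_pos
  constructor <;> nlinarith [mul_nonneg this.le t.2.1, mul_nonneg this.le (sub_nonneg.2 t.2.2)]

theorem family_iterate_three (h : IsFixedParameter c) (hψ : ∀ i, IsExtension c (ψ i)) (α : ℕ → ι)
    {x t : unitInterval} (hx : (x : ℝ) = F₁ c t) :
    ((family h hψ α)^[3] x : ℝ) = F₁ c (family h hψ (fun k => α (k + 1)) t) := by
  have h2 := family_iterate_two h hψ α hx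
  have h1 := h.s₁_pos.ne'
  rw [Function.iterate_succ_apply', family_of_mem_left h hψ α (h2 ▸ s₁_mul_mem h _), h2, F₁]
  field_simp

theorem coe_right_family (h : IsFixedParameter c) (hψ : ∀ i, IsExtension c (ψ i)) (α : ℕ → ι) :
    (right (family h hψ α) : ℝ) = (u c)^[4] 0 := by
  have e : right (family h hψ α) = (family h hψ α)^[3] (left (family h hψ α)) := rfl
  rw [e, family_iterate_three h hψ α (t := 1) (by rw [coe_left_family]; exact h.F₁_one.symm),
    (family h hψ _).map_one]
  exact h.F₁_zero

theorem exists_eq_F₁ (h : IsFixedParameter c) (hψ : ∀ i, IsExtension c (ψ i)) (α : ℕ → ι)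
    {x : unitInterval} (hx : x ∈ interval (family h hψ α)) : ∃ t : unitInterval, (x : ℝ) = F₁ c t := by
  have h1 : (left (family h hψ α) : ℝ) ≤ x := hx.1
  have h2 : (x : ℝ) ≤ right (family h hψ α) := hx.2
  rw [coe_left_family] at h1
  rw [coe_right_family] at h2
  obtain ⟨w, hw, he⟩ := h.mem_F₁_image ⟨h1, h2⟩
  exact ⟨⟨w, hw⟩, he⟩

theorem isRenormalizable_family (h : IsFixedParameter c) (hψ : ∀ i, IsExtension c (ψ i))
    (α : ℕ → ι) : IsRenormalizable (family h hψ α) := by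
  have hJ : ∀ x ∈ interval (family h hψ α), (x : ℝ) ∈ Icc (u c 0) ((u c)^[4] 0) := by
    intro x hx
    obtain ⟨t, ht⟩ := exists_eq_F₁ h hψ α hx
    rw [ht]; exact h.F₁_mem t.2
  have h1 : ∀ x ∈ family h hψ α '' interval (family h hψ α), 1 - s₃ c ≤ (x : ℝ) := by
    rintro _ ⟨x, hx, rfl⟩
    obtain ⟨t, ht⟩ := exists_eq_F₁ h hψ α hx
    rw [family_F₁ h hψ α ht]
    exact (one_sub_mem h _).1
  have h2 : ∀ x ∈ (family h hψ α)^[2] '' interval (family h hψ α), (x : ℝ) ≤ s₁ c := by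
    rintro _ ⟨x, hx, rfl⟩
    obtain ⟨t, ht⟩ := exists_eq_F₁ h hψ α hx
    rw [family_iterate_two h hψ α ht]
    exact (s₁_mul_mem h _).2
  have g1 := h.right_lt
  have g2 := h.s₁_lt
  have g3 := h.left_lt.trans h.lt_right
  refine ⟨?_, ?_, ?_, ?_, ?_, ?_⟩
  · rw [← Subtype.coe_lt_coe, coe_left_family]; exact h.left_lt
  · rw [← Subtype.coe_lt_coe, coe_right_family]; exact h.lt_right
  · refine Disjoint.mono interior_subset interior_subset (Set.disjoint_left.2 fun x a b => ?_)
    linarith [(hJ x a).2, h1 x b]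
  · refine Disjoint.mono interior_subset interior_subset (Set.disjoint_left.2 fun x a b => ?_)
    linarith [(hJ x a).1, h2 x b]
  · refine Disjoint.mono interior_subset interior_subset (Set.disjoint_left.2 fun x a b => ?_)
    linarith [h1 x a, h2 x b]
  · intro x hx
    obtain ⟨t, ht⟩ := exists_eq_F₁ h hψ α hx
    have e := family_iterate_three h hψ α ht
    have := h.F₁_mem (family h hψ (fun k => α (k + 1)) t).2
    constructor
    · rw [← Subtype.coe_le_coe, coe_left_family, e]; exact this.1
    · rw [← Subtype.coe_le_coe, coe_right_family, e]; exact this.2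

theorem R_family (h : IsFixedParameter c) (hψ : ∀ i, IsExtension c (ψ i)) (α : ℕ → ι) :
    R (family h hψ α) = family h hψ fun k => α (k + 1) := by
  have hR := isRenormalizable_family h hψ α
  rw [R, dif_pos hR]
  apply C1LipUnimodal.ext_toMap
  intro t
  have hr : ∀ t, (rescale (family h hψ α) t : ℝ) = F₁ c t := by
    intro t
    rw [coe_rescale, coe_left_family, coe_right_family, F₁, s₂]; ring
  have e : rescale (family h hψ α) (renormMap _ hR t) = _ := rescale_renormMap _ hR t
  have e' := congrArg Subtype.val e
  rw [hr, family_iterate_three h hψ α (hr t)] at e'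
  exact Subtype.ext (h.F₁_injective e')

/-! ### The coding of the family -/

theorem R_iterate_family (h : IsFixedParameter c) (hψ : ∀ i, IsExtension c (ψ i)) (k : ℕ)
    (α : ℕ → ι) : R^[k] (family h hψ α) = family h hψ fun j => α (j + k) := by
  induction k generalizing α with
  | zero => rfl
  | succ k ih => rw [Function.iterate_succ_apply, R_family, ih]; rfl

theorem family_injective (h : IsFixedParameter c) (hψ : ∀ i, IsExtension c (ψ i))
    (hne : ∀ i j, i ≠ j → ¬ EqOn (ψ i) (ψ j) (dom c)) : Function.Injective (family h hψ) := by
  intro α β hαβ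
  funext k
  by_contra hk
  refine hne _ _ hk fun x hx => ?_
  have := congrArg R^[k] hαβ
  rw [R_iterate_family, R_iterate_family] at this
  have h2 : family h hψ (fun j => α (j + k)) ⟨x, h.dom_subset hx⟩
    = family h hψ (fun j => β (j + k)) ⟨x, h.dom_subset hx⟩ := by rw [this]
  have h3 := congrArg Subtype.val h2
  rw [coe_family, coe_family, glueMap_of_mem _ hx, glueMap_of_mem _ hx] at h3
  simpa using h3

theorem dist_extension_le (h : IsFixedParameter c) (hψ : ∀ i, IsExtension c (ψ i)) (α β : ℕ → ι)
    {x : ℝ} (hx : x ∈ dom c) :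
    dist (ψ (α 0) x) (ψ (β 0) x) ≤ dist (family h hψ α).toMap (family h hψ β).toMap := by
  have := ContinuousMap.dist_apply_le_dist (f := (family h hψ α).toMap)
    (g := (family h hψ β).toMap) ⟨x, h.dom_subset hx⟩
  rwa [Subtype.dist_eq, coe_family, coe_family, glueMap_of_mem _ hx, glueMap_of_mem _ hx] at this

theorem exists_entourage_family (h : IsFixedParameter c) (hψ : ∀ i, IsExtension c (ψ i))
    (hne : ∀ i j, i ≠ j → ¬ EqOn (ψ i) (ψ j) (dom c)) :
    ∃ V ∈ uniformity C1LipUnimodal, ∀ α β : ℕ → ι, (family h hψ α, family h hψ β) ∈ V →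
      α 0 = β 0 := by
  have key : ∀ p : ι × ι, ∃ ε : ℝ, 0 < ε ∧
      (p.1 ≠ p.2 → ∃ x ∈ dom c, ε ≤ dist (ψ p.1 x) (ψ p.2 x)) := by
    intro p
    by_cases hij : p.1 = p.2
    · exact ⟨1, one_pos, fun hp => absurd hij hp⟩
    · have := hne _ _ hij
      simp only [EqOn, not_forall] at this
      obtain ⟨x, hx, hxne⟩ := this
      exact ⟨_, dist_pos.2 hxne, fun _ => ⟨x, hx, le_rfl⟩⟩
  choose ε hε hsep using key
  have hmem : ∀ p, {q : C1LipUnimodal × C1LipUnimodal | dist q.1.toMap q.2.toMap < ε p} ∈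
      uniformity C1LipUnimodal := fun p => uniformContinuous_toMap (Metric.dist_mem_uniformity (hε p))
  refine ⟨_, iInter_mem.2 hmem, fun α β hαβ => ?_⟩
  have hlt : dist (family h hψ α).toMap (family h hψ β).toMap < ε (α 0, β 0) :=
    mem_iInter.1 hαβ (α 0, β 0)
  by_contra hne'
  obtain ⟨x, hx, hle⟩ := hsep (α 0, β 0) hne'
  exact absurd (hle.trans (dist_extension_le h hψ α β hx)) (not_le.2 hlt)

variable [TopologicalSpace ι] [DiscreteTopology ι]

theorem continuous_family (h : IsFixedParameter c) (hψ : ∀ i, IsExtension c (ψ i)) :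
    Continuous (family h hψ) := by
  rw [continuous_induced_rng]
  refine Continuous.prodMk ?_ ?_
  · refine continuous_of_common_beginning (r := s₃ c) (B := 2 * 1) h.s₃_pos.le h.s₃_lt_one
      fun k α β hαβ => ?_
    have hs := h.s₃_pos
    refine (ContinuousMap.dist_le (by positivity)).2 fun x => ?_
    have hB : ∀ α : ℕ → ι, ∀ x ∈ Icc (0 : ℝ) 1, |glue c 1 (s₃ c) ψ α x - 1| ≤ 1 := by
      intro α x hx
      have := glueMap_mem h hψ α hx
      rw [glueMap] at this
      exact abs_le.2 ⟨by linarith [this.1], by linarith [this.2]⟩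
    have key := dist_glue_le h (match_left h hψ) (match_right h hψ) hB k hαβ x.2
    rw [abs_of_pos hs] at key
    exact key
  · obtain ⟨K, hK⟩ := exists_lipschitzOnWith_glueSlope h hψ
    refine continuous_of_common_beginning (r := s₂ c) (B := 2 * K) h.s₂_pos.le h.s₂_lt_one
      fun k α β hαβ => ?_
    have hs := h.s₂_pos
    refine (ContinuousMap.dist_le (by positivity)).2 fun x => ?_
    have hB : ∀ α : ℕ → ι, ∀ x ∈ Icc (0 : ℝ) 1,
        |glue c 0 (-s₂ c) (fun i => (hψ i).deriv') α x - 0| ≤ K := by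
      intro α x hx
      have h1 := (hK α).dist_le_mul x hx c ⟨h.pos.le, h.lt_one.le⟩
      rw [Real.dist_eq, Real.dist_eq, glueSlope, glue_self h] at h1
      refine h1.trans (mul_le_of_le_one_right K.2 (abs_le.2 ⟨?_, ?_⟩))
      · linarith [hx.1, h.lt_one]
      · linarith [hx.2, h.pos]
    have key := dist_glue_le h (match_slope_left h hψ) (match_slope_right h hψ) hB k hαβ x.2
    rw [abs_neg, abs_of_pos hs] at key
    exact key

theorem isEmbedding_family (h : IsFixedParameter c) (hψ : ∀ i, IsExtension c (ψ i))
    (hne : ∀ i j, i ≠ j → ¬ EqOn (ψ i) (ψ j) (dom c)) : IsEmbedding (family h hψ) :=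
  ((continuous_family h hψ).isClosedEmbedding (family_injective h hψ hne)).isEmbedding

end Family

/-! ### Entropy of a semiconjugacy with a full shift -/

open Dynamics SetRel in
theorem log_le_coverEntropy {X : Type*} [UniformSpace X] {n : ℕ} [NeZero n] {T : X → X}
    {f : (ℕ → Fin n) → X} (hT : ∀ α, T (f α) = f (shift α)) {V : SetRel X X}
    (hV : V ∈ uniformity X) (hsep : ∀ α β, (f α, f β) ∈ V → α 0 = β 0) :
    ((Real.log n : ℝ) : EReal) ≤ coverEntropy T (range f) := by
  classical
  obtain ⟨U, hU, hUs, hUV⟩ := comp_symm_mem_uniformity_sets hV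
  have hiter : ∀ k α, T^[k] (f α) = f fun j => α (j + k) := by
    intro k
    induction k with
    | zero => intro α; rfl
    | succ k ih =>
      intro α
      rw [Function.iterate_succ_apply, hT, ih]
      rfl
  have hcard : ∀ m : ℕ, ((n ^ m : ℕ) : ℕ∞) ≤ netMaxcard T (range f) U m := by
    intro m
    set g : (Fin m → Fin n) → X := fun a => f fun j => if hj : j < m then a ⟨j, hj⟩ else 0 with hg
    have hshadow : ∀ a b, ∀ x, x ∈ UniformSpace.ball (g a) (dynEntourage T U m) →
        x ∈ UniformSpace.ball (g b) (dynEntourage T U m) → a = b := by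
      intro a b x ha hb
      rw [mem_ball_dynEntourage] at ha hb
      funext j
      have hab : (T^[j] (g a), T^[j] (g b)) ∈ V :=
        hUV ⟨T^[j] x, ha j j.2, hUs.symm _ _ (hb j j.2)⟩
      rw [hg] at hab
      simp only [hiter] at hab
      simpa using hsep _ _ hab
    have hinj : Function.Injective g := by
      intro a b hab
      refine hshadow a b (g a) ?_ ?_
      · rw [mem_ball_dynEntourage]; exact fun k _ => refl_mem_uniformity hU
      · rw [mem_ball_dynEntourage, hab]; exact fun k _ => refl_mem_uniformity hU
    have hnet : IsDynNetIn T (range f) U m (Finset.univ.image g : Finset X) := by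
      refine ⟨?_, ?_⟩
      · intro x hx
        simp only [Finset.coe_image, Finset.coe_univ, image_univ] at hx
        obtain ⟨a, rfl⟩ := hx
        exact ⟨_, rfl⟩
      · intro x hx y hy hxy
        simp only [Finset.coe_image, Finset.coe_univ, image_univ] at hx hy
        obtain ⟨a, rfl⟩ := hx
        obtain ⟨b, rfl⟩ := hy
        exact Set.disjoint_left.2 fun z hz1 hz2 => hxy (by rw [hshadow a b z hz1 hz2])
    have := hnet.card_le_netMaxcard
    rw [Finset.card_image_of_injective _ hinj] at this
    simpa using this
  have h1 : ((Real.log n : ℝ) : EReal) ≤ netEntropyEntourage T (range f) U := by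
    have hlog : ((Real.log n : ℝ) : EReal) = ENNReal.log (n : ENNReal) := by
      rw [← ENNReal.log_ofReal_of_pos (Nat.cast_pos.2 (NeZero.pos n)), ENNReal.ofReal_natCast]
    rw [hlog, ← ExpGrowth.expGrowthSup_pow]
    refine ExpGrowth.expGrowthSup_monotone fun m => ?_
    have := ENat.toENNReal_le.2 (hcard m)
    simpa using this
  exact h1.trans ((netEntropyEntourage_le_coverEntropyEntourage T _).trans
    (coverEntropyEntourage_le_coverEntropy T _ hU))

/-! ### Monotone interpolation with prescribed derivatives -/

/-- A Lipschitz function given by the restriction of a `C¹` function to a compact interval. -/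
theorem exists_lipschitzWith_projIcc {a b : ℝ} (hab : a ≤ b) {D : ℝ → ℝ} (hD : ContDiff ℝ 1 D) :
    ∃ K, LipschitzWith K fun x => D (projIcc a b hab x) := by
  obtain ⟨K, hK⟩ := hD.contDiffOn.exists_lipschitzOnWith (s := Icc a b) one_ne_zero
    (convex_Icc a b) isCompact_Icc
  refine ⟨K, LipschitzWith.of_dist_le_mul fun x y => ?_⟩
  refine (hK.dist_le_mul _ (projIcc a b hab x).2 _ (projIcc a b hab y).2).trans ?_
  gcongr
  have := (LipschitzWith.projIcc hab).dist_le_mul x y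
  simpa [Subtype.dist_eq] using this

/-- Increasing `C^{1+Lip}` functions which are affine with prescribed slopes outside `(a, b)`,
with prescribed values at `a` and `b`, and with different values at the midpoint. -/
theorem exists_interpolation {a b p q A₀ B₀ : ℝ} (hab : a < b) (hp : 0 < p) (hq : 0 < q)
    (hAB : A₀ < B₀) (n : ℕ) :
    ∃ g d : Fin n → ℝ → ℝ, (∀ i x, HasDerivAt (g i) (d i x) x) ∧ (∀ i x, 0 < d i x) ∧
      (∀ i, ∃ K, LipschitzWith K (d i)) ∧ (∀ i, ∀ x ≤ a, g i x = A₀ + p * (x - a) ∧ d i x = p) ∧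
      (∀ i, ∀ x, b ≤ x → g i x = B₀ + q * (x - b) ∧ d i x = q) ∧
      ∀ i j, g i ((a + b) / 2) = g j ((a + b) / 2) → i = j := by
  set L := b - a with hL
  have hL0 : 0 < L := sub_pos.2 hab
  obtain ⟨N, hN⟩ := exists_nat_gt ((p + q) * L / (B₀ - A₀))
  have hBA : 0 < B₀ - A₀ := sub_pos.2 hAB
  have hN' : (p + q) * L < (B₀ - A₀) * (N + 1) := by
    rw [div_lt_iff₀ hBA] at hN
    nlinarith
  have hNpos : 0 < N := by
    have h0 : 0 < (p + q) * L / (B₀ - A₀) := by positivity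
    exact_mod_cast h0.trans hN
  set t : ℝ := 6 * (B₀ - A₀ - (p + q) * L / (N + 1)) / L ^ 3 with ht
  have ht0 : 0 < t := by
    have : (p + q) * L / (N + 1) < B₀ - A₀ := by rwa [div_lt_iff₀ (by positivity)]
    have : 0 < B₀ - A₀ - (p + q) * L / (N + 1) := by linarith
    positivity
  set lam : Fin n → ℝ := fun i => t / (2 * L) * ((i : ℝ) / n) with hlam
  have hlam0 : ∀ i, 0 ≤ lam i ∧ lam i * (2 * L) ≤ t := fun i => by
    have hi : ((i : ℕ) : ℝ) / n ≤ 1 := (div_le_one (Nat.cast_pos.2 i.pos)).2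
      (Nat.cast_le.2 i.2.le)
    refine ⟨by positivity, ?_⟩
    have : lam i * (2 * L) = t * ((i : ℝ) / n) := by simp only [hlam]; field_simp
    rw [this]
    exact mul_le_of_le_one_right ht0.le hi
  -- the interpolating polynomials
  set P : Fin n → ℝ → ℝ := fun i x => A₀ + p * L / (N + 1) * (1 - ((b - x) / L) ^ (N + 1))
    + q * L / (N + 1) * ((x - a) / L) ^ (N + 1)
    + t * (L * (x - a) ^ 2 / 2 - (x - a) ^ 3 / 3) + lam i * ((x - a) ^ 2 * (b - x) ^ 2) with hP
  set D : Fin n → ℝ → ℝ := fun i x => p * ((b - x) / L) ^ N + q * ((x - a) / L) ^ N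
    + (x - a) * (b - x) * (t + lam i * (2 * (a + b - 2 * x))) with hD
  have hPD : ∀ i x, HasDerivAt (P i) (D i x) x := by
    intro i x
    have hx := hasDerivAt_id x
    have e1 := (((((hx.const_sub b).div_const L).pow (N + 1)).const_sub 1).const_mul
      (p * L / (N + 1))).const_add A₀
    have e2 := (((hx.sub_const a).div_const L).pow (N + 1)).const_mul (q * L / (N + 1))
    have e3 := (((((hx.sub_const a).pow 2).const_mul L).div_const 2).sub
      (((hx.sub_const a).pow 3).div_const 3)).const_mul t
    have e4 := (((hx.sub_const a).pow 2).mul ((hx.const_sub b).pow 2)).const_mul (lam i)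
    refine ((((e1.add e2).add e3).add e4).congr_of_eventuallyEq
      (Eventually.of_forall fun y => ?_)).congr_deriv ?_
    · simp [hP]
    · simp only [hD, id, Pi.pow_apply, Nat.add_sub_cancel, Nat.cast_add, Nat.cast_one, Nat.cast_ofNat]
      have : (N : ℝ) + 1 ≠ 0 := by positivity
      have hb : b = a + L := by rw [hL]; ring
      rw [show p * L / (N + 1) * -((N + 1) * ((b - x) / L) ^ N * (-1 / L))
          = p * ((b - x) / L) ^ N by field_simp,
        show q * L / (N + 1) * ((N + 1) * ((x - a) / L) ^ N * (1 / L))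
          = q * ((x - a) / L) ^ N by field_simp, hb]
      ring
  have hPa : ∀ i, P i a = A₀ := fun i => by
    simp [hP, ← hL, div_self hL0.ne']
  have hPb : ∀ i, P i b = B₀ := fun i => by
    have : (N : ℝ) + 1 ≠ 0 := by positivity
    simp only [hP, ← hL, div_self hL0.ne', sub_self, zero_div, ht]
    field_simp
    ring
  have hDa : ∀ i, D i a = p := fun i => by
    simp [hD, ← hL, div_self hL0.ne', hNpos.ne']
  have hDb : ∀ i, D i b = q := fun i => by
    simp [hD, ← hL, div_self hL0.ne', hNpos.ne']
  have hDpos : ∀ i, ∀ x ∈ Icc a b, 0 < D i x := by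
    intro i x hx
    have h1 : 0 ≤ x - a := sub_nonneg.2 hx.1
    have h2 : 0 ≤ b - x := sub_nonneg.2 hx.2
    have h3 : 0 ≤ (x - a) * (b - x) * (t + lam i * (2 * (a + b - 2 * x))) := by
      refine mul_nonneg (mul_nonneg h1 h2) ?_
      have := mul_nonneg (hlam0 i).1 (show 0 ≤ 2 * L + 2 * (a + b - 2 * x) by rw [hL]; linarith)
      nlinarith [(hlam0 i).2]
    have h4 : 0 ≤ p * ((b - x) / L) ^ N := by positivity
    have h5 : 0 ≤ q * ((x - a) / L) ^ N := by positivity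
    have h6 : 0 < p * ((b - x) / L) ^ N + q * ((x - a) / L) ^ N := by
      rcases eq_or_lt_of_le h1 with h | h
      · have : 0 < b - x := by linarith
        have : 0 < p * ((b - x) / L) ^ N := by positivity
        linarith
      · have : 0 < q * ((x - a) / L) ^ N := by positivity
        linarith
    simp only [hD]; linarith
  have hDdiff : ∀ i, ContDiff ℝ 1 (D i) := fun i => by
    simp only [hD]; fun_prop
  set d : Fin n → ℝ → ℝ := fun i x => D i (projIcc a b hab.le x) with hd
  have hdcont : ∀ i, Continuous (d i) := fun i =>
    (hDdiff i).continuous.comp (continuous_subtype_val.comp continuous_projIcc)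
  set g : Fin n → ℝ → ℝ := fun i x => A₀ + ∫ y in a..x, d i y with hg
  have hgd : ∀ i x, HasDerivAt (g i) (d i x) x := fun i x =>
    (intervalIntegral.integral_hasDerivAt_right ((hdcont i).intervalIntegrable _ _)
      ((hdcont i).stronglyMeasurableAtFilter _ _) (hdcont i).continuousAt).const_add A₀
  have dleft : ∀ i, ∀ x ≤ a, d i x = p := fun i x hx => by
    simp only [hd]; rw [projIcc_of_le_left _ hx]; exact hDa i
  have dright : ∀ i, ∀ x, b ≤ x → d i x = q := fun i x hx => by
    simp only [hd]; rw [projIcc_of_right_le _ hx]; exact hDb i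
  have gmid : ∀ i, ∀ x ∈ Icc a b, g i x = P i x := by
    intro i x hx
    have e : ∫ y in a..x, d i y = ∫ y in a..x, D i y := by
      refine intervalIntegral.integral_congr fun y hy => ?_
      rw [uIcc_of_le hx.1] at hy
      simp only [hd]; rw [projIcc_of_mem hab.le ⟨hy.1, hy.2.trans hx.2⟩]
    simp only [hg]
    rw [e, intervalIntegral.integral_eq_sub_of_hasDerivAt (fun y _ => hPD i y)
      ((hDdiff i).continuous.intervalIntegrable _ _), hPa]
    ring
  refine ⟨g, d, hgd, fun i x => hDpos i _ (projIcc a b hab.le x).2,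
    fun i => exists_lipschitzWith_projIcc hab.le (hDdiff i), ?_, ?_, ?_⟩
  · intro i x hx
    refine ⟨?_, dleft i x hx⟩
    have e : ∫ y in a..x, d i y = ∫ y in a..x, p := by
      refine intervalIntegral.integral_congr fun y hy => ?_
      rw [uIcc_of_ge hx] at hy
      exact dleft i y hy.2
    simp only [hg]
    rw [e, intervalIntegral.integral_const, smul_eq_mul]; ring
  · intro i x hx
    refine ⟨?_, dright i x hx⟩
    have e : ∫ y in b..x, d i y = ∫ y in b..x, q := by
      refine intervalIntegral.integral_congr fun y hy => ?_
      rw [uIcc_of_le hx] at hy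
      exact dright i y hy.1
    have e' : A₀ + ∫ y in a..b, d i y = B₀ := (gmid i b ⟨hab.le, le_rfl⟩).trans (hPb i)
    simp only [hg]
    rw [← intervalIntegral.integral_add_adjacent_intervals ((hdcont i).intervalIntegrable a b)
      ((hdcont i).intervalIntegrable b x), e, intervalIntegral.integral_const, smul_eq_mul,
      ← add_assoc, e']
    ring
  · intro i j hij
    rw [gmid i _ ⟨by linarith, by linarith⟩, gmid j _ ⟨by linarith, by linarith⟩] at hij
    simp only [hP, add_right_inj] at hij
    have hne : ((a + b) / 2 - a) ^ 2 * (b - (a + b) / 2) ^ 2 ≠ 0 := by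
      have h1 : (a + b) / 2 - a = L / 2 := by rw [hL]; ring
      have h2 : b - (a + b) / 2 = L / 2 := by rw [hL]; ring
      rw [h1, h2]; positivity
    have := mul_right_cancel₀ hne hij
    simp only [hlam] at this
    have h3 := mul_left_cancel₀ (by positivity : t / (2 * L) ≠ 0) this
    have hn : (n : ℝ) ≠ 0 := Nat.cast_ne_zero.2 i.pos.ne'
    rw [div_left_inj' hn] at h3
    exact Fin.ext (by exact_mod_cast h3)

/-! ### Existence of extensions -/

theorem F₁_iterate_image_Icc {c : ℝ} (h : IsFixedParameter c) (n : ℕ) {x : ℝ}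
    (hx : x ∈ (F₁ c)^[n] '' Icc (0 : ℝ) 1) : x ∈ Icc (0 : ℝ) 1 := by
  obtain ⟨w, hw, rfl⟩ := hx
  induction n generalizing w with
  | zero => exact hw
  | succ n ih => exact ih (F₁ c w) (h.F₁_mem_unit hw)

/-- The second and deeper levels meet `dom c` only in the common end points of the first two. -/
theorem eq_of_F₁_iterate_mem_dom {c : ℝ} (h : IsFixedParameter c) {n : ℕ} {w : ℝ}
    (hw : w ∈ Icc (0 : ℝ) 1) (hd : (F₁ c)^[n + 1] w ∈ dom c) : n = 0 ∧ (w = 0 ∨ w = 1) := by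
  have hmem := F₁_iterate_image_Icc h n ⟨w, hw, rfl⟩
  rw [Function.iterate_succ_apply'] at hd
  have h01 := h.eq_zero_or_one_of_F₁_mem_dom hmem hd
  cases n with
  | zero => exact ⟨rfl, h01⟩
  | succ n =>
    exfalso
    rw [Function.iterate_succ_apply'] at h01
    have := h.F₁_mem (F₁_iterate_image_Icc h n ⟨w, hw, rfl⟩)
    rcases h01 with e | e
    · rw [e] at this; linarith [this.1, h.left_pos]
    · rw [e] at this; linarith [this.2, h.right_lt_one]

/-- Sufficient conditions for an extension, given separately on the two components of `dom c`. -/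
theorem isExtension_of_pieces {c : ℝ} (h : IsFixedParameter c) {g₁ d₁ g₂ d₂ : ℝ → ℝ}
    (hd₁ : ∀ x, HasDerivAt g₁ (d₁ x) x) (hd₂ : ∀ x, HasDerivAt g₂ (d₂ x) x)
    (pos : ∀ x, 0 < d₁ x) (neg : ∀ x, d₂ x < 0)
    (lip₁ : ∃ K, LipschitzWith K d₁) (lip₂ : ∃ K, LipschitzWith K d₂)
    (left₁ : ∀ x ≤ s₁ c, g₁ x = u c 0 + s₂ c / s₁ c * x)
    (right₁ : g₁ (u c 0) = 1 - s₃ c ∧ d₁ (u c 0) = -s₂ c * -(s₁ c / s₃ c))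
    (left₂ : g₂ ((u c)^[4] 0) = 1 - s₃ c * (1 - u c 0) ∧
      d₂ ((u c)^[4] 0) = -s₂ c * (s₂ c / s₁ c))
    (right₂ : ∀ x, 1 - s₃ c ≤ x → g₂ x = s₁ c / s₃ c * (1 - x)) :
    IsExtension c fun x => if x ≤ c then g₁ x else g₂ x := by
  have hs₃ := h.s₃_pos
  have hlr := h.left_lt.trans h.lt_right
  have e₁ : ∀ x ≤ u c 0, x ≤ c := fun x hx => hx.trans h.left_lt.le
  have e₂ : ∀ x, (u c)^[4] 0 ≤ x → ¬ x ≤ c := fun x hx => not_le.2 (h.lt_right.trans_le hx)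
  have mono₁ : StrictMono g₁ := strictMono_of_hasDerivAt_pos hd₁ pos
  have anti₂ : StrictAnti g₂ := strictAnti_of_hasDerivAt_neg hd₂ neg
  refine ⟨?_, ?_, ?_⟩
  · rintro x (hx | hx)
    · simp only [if_pos (e₁ x hx.2)]
      constructor
      · have := mono₁.monotone hx.1
        rw [left₁ 0 h.s₁_pos.le] at this
        linarith [h.left_pos]
      · have := mono₁.monotone hx.2
        rw [right₁.1] at this; linarith
    · simp only [if_neg (e₂ x hx.1)]
      constructor
      · have := anti₂.antitone hx.2
        rw [right₂ 1 (by linarith)] at this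
        linarith
      · have := anti₂.antitone hx.1
        rw [left₂.1] at this
        nlinarith [mul_pos hs₃ (show 0 < 1 - u c 0 by linarith [h.left_lt, h.lt_one])]
  · intro n
    cases n with
    | zero =>
      constructor
      · rintro x ⟨-, hx⟩
        simp only [Function.iterate_zero, image_id, id] at hx ⊢
        rw [h.chord_zero_s₁, if_pos (e₁ x (hx.2.trans h.s₁_lt.le)), left₁ x hx.2]
      · rintro x ⟨-, hx⟩
        simp only [Function.iterate_zero, image_id, id] at hx ⊢
        rw [h.chord_s₃_one, if_neg (e₂ x (h.right_lt.le.trans hx.1)), right₂ x hx.1]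
    | succ n =>
      constructor
      · rintro _ ⟨hxd, w, hw, rfl⟩
        have hw1 : w < 1 := hw.2.trans_lt (h.s₁_lt.trans (h.left_lt.trans h.lt_one))
        obtain ⟨rfl, rfl | rfl⟩ := eq_of_F₁_iterate_mem_dom h ⟨hw.1, hw1.le⟩ hxd
        · simp only [zero_add, Function.iterate_one]
          rw [h.chord_F₁ h.s₁_pos.ne, h.chord_zero_s₁, h.F₁_zero, if_neg (e₂ _ le_rfl), left₂.1,
            F₂, mul_zero, add_zero]
        · exact absurd hw1 (lt_irrefl _)
      · rintro _ ⟨hxd, w, hw, rfl⟩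
        have hw0 : 0 < w := by linarith [hw.1, h.s₃_lt_one]
        obtain ⟨rfl, rfl | rfl⟩ := eq_of_F₁_iterate_mem_dom h ⟨hw0.le, hw.2⟩ hxd
        · exact absurd hw0 (lt_irrefl _)
        · simp only [zero_add, Function.iterate_one]
          rw [h.chord_F₁ (by linarith), h.chord_s₃_one, h.F₁_one, if_pos (e₁ _ le_rfl), right₁.1,
            F₂]
          ring
  · refine ⟨fun x => if x ≤ c then d₁ x else d₂ x, ?_, ?_, ?_, ?_, ?_⟩
    · intro x hx
      refine HasDerivAt.hasDerivWithinAt ?_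
      have hxc : x ≠ c := fun e => h.notMem_dom (e ▸ hx)
      rcases lt_or_gt_of_ne hxc with hlt | hlt
      · simp only [if_pos hlt.le]
        refine (hd₁ x).congr_of_eventuallyEq ?_
        filter_upwards [gt_mem_nhds hlt] with y hy
        exact if_pos (le_of_lt hy)
      · simp only [if_neg (not_le.2 hlt)]
        refine (hd₂ x).congr_of_eventuallyEq ?_
        filter_upwards [lt_mem_nhds hlt] with y hy
        exact if_neg (not_le.2 hy)
    · obtain ⟨K₁, hK₁⟩ := lip₁
      obtain ⟨K₂, hK₂⟩ := lip₂
      obtain ⟨C₁, hC₁⟩ := (isCompact_Icc (a := (0 : ℝ)) (b := 1)).exists_bound_of_continuousOn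
        hK₁.continuous.continuousOn
      obtain ⟨C₂, hC₂⟩ := (isCompact_Icc (a := (0 : ℝ)) (b := 1)).exists_bound_of_continuousOn
        hK₂.continuous.continuousOn
      have hC₁0 : 0 ≤ C₁ := (norm_nonneg _).trans (hC₁ 0 (by simp))
      have hC₂0 : 0 ≤ C₂ := (norm_nonneg _).trans (hC₂ 0 (by simp))
      have hgap : 0 < (u c)^[4] 0 - u c 0 := sub_pos.2 hlr
      set K₃ : NNReal := ⟨(C₁ + C₂) / ((u c)^[4] 0 - u c 0), by positivity⟩ with hK₃
      have cross : ∀ x ∈ Icc 0 (u c 0), ∀ y ∈ Icc ((u c)^[4] 0) 1,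
          |d₁ x - d₂ y| ≤ K₃ * |x - y| := by
        intro x hx y hy
        have a1 := hC₁ x (h.dom_subset (Or.inl hx))
        have a2 := hC₂ y (h.dom_subset (Or.inr hy))
        have a3 : (u c)^[4] 0 - u c 0 ≤ |x - y| := by
          rw [abs_sub_comm]
          exact le_trans (by linarith [hx.2, hy.1]) (le_abs_self _)
        have a4 : C₁ + C₂ = K₃ * ((u c)^[4] 0 - u c 0) :=
          (div_mul_cancel₀ _ hgap.ne').symm
        have a5 : (K₃ : ℝ) * ((u c)^[4] 0 - u c 0) ≤ K₃ * |x - y| := by gcongr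
        rw [Real.norm_eq_abs] at a1 a2
        exact (abs_sub _ _).trans (by linarith)
      refine ⟨K₁ + K₂ + K₃, LipschitzOnWith.of_dist_le_mul fun x hx y hy => ?_⟩
      rw [Real.dist_eq, Real.dist_eq]
      push_cast
      have m1 : (K₁ : ℝ) * |x - y| ≤ (K₁ + K₂ + K₃) * |x - y| := by
        gcongr; linarith [K₂.2, K₃.2]
      have m2 : (K₂ : ℝ) * |x - y| ≤ (K₁ + K₂ + K₃) * |x - y| := by
        gcongr; linarith [K₁.2, K₃.2]
      have m3 : (K₃ : ℝ) * |x - y| ≤ (K₁ + K₂ + K₃) * |x - y| := by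
        gcongr; linarith [K₁.2, K₂.2]
      rcases hx with hx | hx <;> rcases hy with hy | hy
      · rw [if_pos (e₁ x hx.2), if_pos (e₁ y hy.2)]
        exact (hK₁.dist_le_mul x y).trans m1
      · rw [if_pos (e₁ x hx.2), if_neg (e₂ y hy.1)]
        exact (cross x hx y hy).trans m3
      · rw [if_neg (e₂ x hx.1), if_pos (e₁ y hy.2), abs_sub_comm]
        have := cross y hy x hx
        rw [abs_sub_comm y] at this
        exact this.trans m3
      · rw [if_neg (e₂ x hx.1), if_neg (e₂ y hy.1)]
        exact (hK₂.dist_le_mul x y).trans m2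
    · intro x _
      dsimp only
      split_ifs
      · exact (pos x).ne'
      · exact (neg x).ne
    · rw [h.slope_F₁_left, h.F₁_one]
      exact (if_pos (e₁ _ le_rfl)).trans right₁.2
    · rw [h.slope_F₁_right, h.F₁_zero]
      exact (if_neg (e₂ _ le_rfl)).trans left₂.2

theorem exists_extensions {c : ℝ} (h : IsFixedParameter c) (n : ℕ) :
    ∃ ψ : Fin n → ℝ → ℝ, (∀ i, IsExtension c (ψ i)) ∧
      ∀ i j, i ≠ j → ¬ EqOn (ψ i) (ψ j) (dom c) := by
  have hs₁ := h.s₁_pos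
  have hs₂ := h.s₂_pos
  have hs₃ := h.s₃_pos
  have hs₁y := h.s₁_lt
  have hzs := h.right_lt
  obtain ⟨g₁, d₁, hd₁, pos₁, lip₁, left₁, right₁, inj₁⟩ := exists_interpolation
    (p := s₂ c / s₁ c) (q := -s₂ c * -(s₁ c / s₃ c)) hs₁y (by positivity)
    (by rw [neg_mul_neg]; positivity) hzs n
  have hlt : -(1 - s₃ c * (1 - u c 0)) < -s₁ c := by
    nlinarith [mul_pos hs₃ h.left_pos, h.left_lt, h.lt_right]
  obtain ⟨g₂, d₂, hd₂, pos₂, lip₂, left₂, right₂, -⟩ := exists_interpolation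
    (p := s₂ c * (s₂ c / s₁ c)) (q := s₁ c / s₃ c) hzs (by positivity)
    (by positivity) hlt 1
  refine ⟨fun i x => if x ≤ c then g₁ i x else -g₂ 0 x, fun i => ?_, fun i j hij he => ?_⟩
  · refine isExtension_of_pieces h (d₁ := d₁ i) (d₂ := fun x => -d₂ 0 x) (hd₁ i)
      (fun x => (hd₂ 0 x).neg) (pos₁ i) (fun x => neg_lt_zero.2 (pos₂ 0 x)) (lip₁ i) ?_ ?_ ?_ ?_ ?_
    · obtain ⟨K, hK⟩ := lip₂ 0
      exact ⟨K, hK.neg⟩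
    · intro x hx
      rw [(left₁ i x hx).1, show (u c)^[4] 0 = u c 0 + s₂ c by simp [s₂]]
      field_simp
      ring
    · exact ⟨by rw [(right₁ i _ le_rfl).1]; ring, (right₁ i _ le_rfl).2⟩
    · rw [(left₂ 0 _ le_rfl).1, (left₂ 0 _ le_rfl).2]
      constructor <;> ring
    · intro x hx
      rw [(right₂ 0 x hx).1]
      field_simp
      ring
  · have hm : (s₁ c + u c 0) / 2 ∈ dom c := Or.inl ⟨by linarith, by linarith⟩
    have := he hm
    have hmc : (s₁ c + u c 0) / 2 ≤ c := by linarith [h.left_lt]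
    simp only [if_pos hmc] at this
    exact hij (inj₁ i j this)

/-! ### Entropy of the renormalization operator -/

theorem log_le_coverEntropy_family {c : ℝ} (h : IsFixedParameter c) {n : ℕ} (hn : 1 ≤ n)
    {ψ : Fin n → ℝ → ℝ} (hψ : ∀ i, IsExtension c (ψ i))
    (hne : ∀ i j, i ≠ j → ¬ EqOn (ψ i) (ψ j) (dom c)) :
    ((Real.log n : ℝ) : EReal) ≤ Dynamics.coverEntropy R (range (family h hψ)) := by
  have : NeZero n := ⟨by omega⟩
  obtain ⟨V, hV, hsep⟩ := exists_entourage_family h hψ hne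
  exact log_le_coverEntropy (R_family h hψ) hV hsep

theorem log_le_entropyR {n : ℕ} (hn : 1 ≤ n) : ((Real.log n : ℝ) : EReal) ≤ entropyR := by
  obtain ⟨c, h⟩ := exists_isFixedParameter
  obtain ⟨ψ, hψ, hne⟩ := exists_extensions h n
  refine (log_le_coverEntropy_family h hn hψ hne).trans ?_
  refine le_iSup_of_le (range (family h hψ)) (le_iSup_of_le
    (isCompact_range (continuous_family h hψ)) (le_iSup_of_le ?_ (le_iSup_of_le ?_ le_rfl)))
  · rintro _ ⟨α, rfl⟩
    exact isRenormalizable_family h hψ α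
  · rintro _ ⟨α, rfl⟩
    exact ⟨_, (R_family h hψ α).symm⟩

theorem entropyR_eq_top : entropyR = ⊤ := by
  rw [EReal.eq_top_iff_forall_lt]
  intro y
  have hlog : Tendsto (fun n : ℕ => Real.log n) atTop atTop :=
    Real.tendsto_log_atTop.comp tendsto_natCast_atTop_atTop
  obtain ⟨n, hn1, hn⟩ := ((hlog.eventually_gt_atTop y).and (eventually_ge_atTop 1)).exists
  exact (EReal.coe_lt_coe_iff.2 hn1).trans_le (log_le_entropyR hn)

end Tripling

theorem mainTheorem3 :
    (∃ c : ℝ, Tripling.IsFixedParameter c) ∧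
    (∀ c : ℝ, Tripling.IsFixedParameter c → ∀ n : ℕ, 1 ≤ n →
      (∃ ψ : Fin n → ℝ → ℝ, (∀ i, Tripling.IsExtension c (ψ i)) ∧
        ∀ i j, i ≠ j → ¬ EqOn (ψ i) (ψ j) (Tripling.dom c)) ∧
      ∀ ψ : Fin n → ℝ → ℝ, (∀ i, Tripling.IsExtension c (ψ i)) →
        (∀ i j, i ≠ j → ¬ EqOn (ψ i) (ψ j) (Tripling.dom c)) →
        ∃ f : (ℕ → Fin n) → Tripling.C1LipUnimodal,
          (∀ α, (f α).graph =
            insert (c, 1) (⋃ k : ℕ, (Tripling.F c)^[k] '' Tripling.graphOn c (ψ (α k)))) ∧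
          (∀ α, Tripling.ExtendsOn c
            (fun x => (f α (projIcc 0 1 zero_le_one x) : ℝ)) (Icc 0 1)) ∧
          (∀ α, Tripling.QuadraticTip (f α)) ∧
          (∀ α, Tripling.IsRenormalizable (f α)) ∧
          (∀ α, Tripling.R (f α) = f (Tripling.shift α)) ∧
          IsEmbedding f ∧
          ((Real.log n : ℝ) : EReal) ≤ Dynamics.coverEntropy Tripling.R (range f)) ∧
    0 < Tripling.entropyR ∧
    ((Real.log 3 : ℝ) : EReal) ≤ Tripling.entropyR ∧
    Tripling.entropyR = ⊤ := by
  open Tripling in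
  refine ⟨exists_isFixedParameter, fun c h n hn => ⟨exists_extensions h n, fun ψ hψ hne =>
    ⟨family h hψ, graph_family h hψ, extendsOn_family h hψ, quadraticTip_family h hψ,
      isRenormalizable_family h hψ, R_family h hψ, isEmbedding_family h hψ hne,
      log_le_coverEntropy_family h hn hψ hne⟩⟩, ?_, ?_, entropyR_eq_top⟩
  · rw [entropyR_eq_top]; exact EReal.zero_lt_top
  · rw [entropyR_eq_top]; exact le_top
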